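/- Let $\Sigma=\{u\in H^1(\mathbb R^2;\mathbb C): xu\in L^2(\mathbb R^2)\}$ with norm $\|u\|_\Sigma^2=\|\nabla u\|_{L^2}^2+\|xu\|_{L^2}^2+\|u\|_{L^2}^2$. Let $\sigma\colon\mathbb R^2\to[0,\infty)$ be continuous, bounded and not identically zero, let $\alpha\ge 0$, and for $u\in\Sigma$ put $$\mathcal H(u)=\tfrac12\left(\|\nabla u\|_{L^2}^2+\|xu\|_{L^2}^2\right)+\tfrac14\|u\|_{L^4}^4,\qquad \mathcal K(u)=\int_{\mathbb R^2}\left(\sigma(x)-\alpha|u(x)|^2\right)|u(x)|^2\,dx .$$ For $M>0$ let $\mu_M=\inf\{\mathcal H(u): u\in\Sigma,\ \|u\|_{L^2}^2=M\}$, and call $u\in\Sigma$ a minimiser at mass $M$ if $\|u\|_{L^2}^2=M$ and $\mathcal H(u)=\mu_M$. Then: (a) For every $M>0$ there is exactly one minimiser $v_M$ at mass $M$ that is real and non-negative almost everywhere. (b) The map $M\mapsto\mu_M=\mathcal H(v_M)$ is continuous on $(0,\infty)$. (c) Let $M>0$ and let $(M_n)$ be a sequence in $(0,\infty)$ with $M_n\to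 M$. Then $v_{M_n}\to v_M$ in $\Sigma$ and in $L^4(\mathbb R^2)$, and $\mathcal K(v_{M_n})\to\mathcal K(v_M)$ and $\mathcal H(v_{M_n})\to\mathcal H(v_M)$. The last two convergences hold more generally when $v_{M_n}$ and $v_M$ are replaced by arbitrary (complex-valued, not necessarily non-negative) minimisers at masses $M_n$ and $M$. -/

import Mathlib

open MeasureTheory Set Filter Topology
open scoped ENNReal ContDiff

/-- The plane with its Euclidean norm. -/
abbrev Plane : Type := EuclideanSpace ℝ (Fin 2)

/-- The space of (classes of) square-integrable complex functions on the plane. -/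
abbrev L2 : Type := Lp ℂ 2 (volume : Measure Plane)

/-- `g` is the weak partial derivative of `u` in the `i`-th coordinate direction. -/
def IsWeakPartial (i : Fin 2) (u g : L2) : Prop :=
  ∀ φ : Plane → ℝ, ContDiff ℝ ∞ φ → HasCompactSupport φ →
    ∫ x, (fderiv ℝ φ x (EuclideanSpace.single i 1)) • u x = - ∫ x, φ x • g x

/-- A bounded compactly supported continuous multiplier makes an `L²` function integrable. -/
theorem integrable_test_smul {ψ : Plane → ℝ} (hψ : Continuous ψ) (hc : HasCompactSupport ψ)
    (u : L2) : Integrable (fun x => ψ x • u x) := by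
  have h : LocallyIntegrable (fun x => u x) (volume : Measure Plane) :=
    (Lp.memLp u).locallyIntegrable (by norm_num)
  exact h.integrable_smul_left_of_hasCompactSupport hψ hc

theorem continuous_partial {φ : Plane → ℝ} (h : ContDiff ℝ ∞ φ) (e : Plane) :
    Continuous (fun x => fderiv ℝ φ x e) :=
  (h.continuous_fderiv (by simp)).clm_apply continuous_const

theorem hasCompactSupport_partial {φ : Plane → ℝ} (h : HasCompactSupport φ) (e : Plane) :
    HasCompactSupport (fun x => fderiv ℝ φ x e) :=
  h.fderiv_apply (𝕜 := ℝ) e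

theorem IsWeakPartial.add {i : Fin 2} {u g v k : L2} (hu : IsWeakPartial i u g)
    (hv : IsWeakPartial i v k) : IsWeakPartial i (u + v) (g + k) := by
  intro φ hφ hc
  have hd := continuous_partial hφ (EuclideanSpace.single i 1)
  have hdc := hasCompactSupport_partial hc (EuclideanSpace.single i 1)
  have h1 : ∀ (ψ : Plane → ℝ) (_ : Continuous ψ) (_ : HasCompactSupport ψ) (a b : L2),
      ∫ x, ψ x • (a + b : L2) x = (∫ x, ψ x • a x) + ∫ x, ψ x • b x := by
    intro ψ h h' a b
    rw [← integral_add (integrable_test_smul h h' a) (integrable_test_smul h h' b)]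
    refine integral_congr_ae ?_
    filter_upwards [Lp.coeFn_add a b] with x hx
    rw [hx, Pi.add_apply, smul_add]
  rw [h1 _ hd hdc, h1 _ hφ.continuous hc, hu φ hφ hc, hv φ hφ hc, neg_add]

theorem IsWeakPartial.smul {i : Fin 2} {u g : L2} (c : ℂ) (hu : IsWeakPartial i u g) :
    IsWeakPartial i (c • u) (c • g) := by
  intro φ hφ hc
  have h1 : ∀ (ψ : Plane → ℝ) (a : L2), ∫ x, ψ x • (c • a : L2) x = c • ∫ x, ψ x • a x := by
    intro ψ a
    rw [← integral_smul]
    refine integral_congr_ae ?_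
    filter_upwards [Lp.coeFn_smul c a] with x hx
    rw [hx, Pi.smul_apply, smul_comm]
  rw [h1, h1, hu φ hφ hc, smul_neg]

theorem IsWeakPartial.unique {i : Fin 2} {u g k : L2} (hg : IsWeakPartial i u g)
    (hk : IsWeakPartial i u k) : g = k := by
  refine Lp.ext ?_
  refine ae_eq_of_integral_contDiff_smul_eq ((Lp.memLp g).locallyIntegrable (by norm_num))
    ((Lp.memLp k).locallyIntegrable (by norm_num)) fun φ hφ hc => ?_
  have := (hg φ hφ hc).symm.trans (hk φ hφ hc)
  exact neg_injective this

/-- The energy space `Σ = {u ∈ H¹ : x u ∈ L²}`. -/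
def energySpace : Submodule ℂ L2 where
  carrier := {u | (∀ i, ∃ g, IsWeakPartial i u g) ∧
    MemLp (fun x : Plane => (‖x‖ : ℂ) * u x) 2 volume}
  add_mem' := by
    rintro u v ⟨hu, hu'⟩ ⟨hv, hv'⟩
    refine ⟨fun i => ?_, (hu'.add hv').ae_eq ?_⟩
    · obtain ⟨g, hg⟩ := hu i
      obtain ⟨k, hk⟩ := hv i
      exact ⟨g + k, hg.add hk⟩
    · filter_upwards [Lp.coeFn_add u v] with x hx
      simp only [hx, Pi.add_apply, mul_add]
  zero_mem' := by
    refine ⟨fun i => ⟨0, ?_⟩, (MemLp.zero' : MemLp (fun _ : Plane => (0 : ℂ)) 2 volume).ae_eq ?_⟩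
    · have h : ∀ ψ : Plane → ℝ, ∫ x, ψ x • (0 : L2) x = 0 := by
        intro ψ
        refine integral_eq_zero_of_ae ?_
        filter_upwards with x
        simp
      intro φ _ _
      rw [h, h, neg_zero]
    · filter_upwards with x
      simp
  smul_mem' := by
    rintro c u ⟨hu, hu'⟩
    refine ⟨fun i => ?_, (hu'.const_smul c).ae_eq ?_⟩
    · obtain ⟨g, hg⟩ := hu i
      exact ⟨c • g, hg.smul c⟩
    · filter_upwards [Lp.coeFn_smul c u] with x hx
      simp only [hx, Pi.smul_apply, smul_eq_mul]
      ring

/-- The weak partial derivative `∂ᵢ u ∈ L²` of `u ∈ Σ` (it is unique). -/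
noncomputable def weakPartial (i : Fin 2) (u : energySpace) : L2 :=
  (u.2.1 i).choose

/-- `‖∇u‖²` in `L²`. -/
noncomputable def gradSq (u : energySpace) : ℝ :=
  ∑ i, ‖weakPartial i u‖ ^ 2

/-- `‖x u‖²` in `L²`. -/
noncomputable def momentSq (u : energySpace) : ℝ :=
  ∫ x : Plane, ‖x‖ ^ 2 * ‖(u : L2) x‖ ^ 2

/-- `‖u‖⁴` in `L⁴`. -/
noncomputable def quarticNorm (u : energySpace) : ℝ :=
  ∫ x : Plane, ‖(u : L2) x‖ ^ 4

/-- The mass `‖u‖²` in `L²`. -/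
noncomputable def mass (u : energySpace) : ℝ :=
  ‖(u : L2)‖ ^ 2

/-- The norm of `Σ`. -/
noncomputable def sigmaNorm (u : energySpace) : ℝ :=
  Real.sqrt (gradSq u + momentSq u + mass u)

/-- The Hamiltonian. -/
noncomputable def hamiltonian (u : energySpace) : ℝ :=
  (1 / 2) * (gradSq u + momentSq u) + (1 / 4) * quarticNorm u

/-- The pumping/damping functional `𝒦(u) = ∫ (σ - α|u|²)|u|²`. -/
noncomputable def pumping (σ : Plane → ℝ) (α : ℝ) (u : energySpace) : ℝ :=
  ∫ x : Plane, (σ x - α * ‖(u : L2) x‖ ^ 2) * ‖(u : L2) x‖ ^ 2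

/-- The infimum `μ_M` of the Hamiltonian at mass `M`. -/
noncomputable def minEnergy (M : ℝ) : ℝ :=
  sInf (hamiltonian '' {u | mass u = M})

/-- `u` minimises the Hamiltonian at mass `M`. -/
def IsMinimizer (M : ℝ) (u : energySpace) : Prop :=
  mass u = M ∧ ∀ w : energySpace, mass w = M → hamiltonian u ≤ hamiltonian w

/-- `u` minimises the Hamiltonian at mass `M` and is real and non-negative almost everywhere. -/
def IsGroundState (M : ℝ) (u : energySpace) : Prop :=
  IsMinimizer M u ∧ ∀ᵐ x : Plane, (u : L2) x = (‖(u : L2) x‖ : ℂ)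

/-! The energy is strictly convex as a function of the density. The quadratic mean `√((|u|² + |v|²)
/ 2)` has the average of the two masses and of the two moments, its gradient energy is at most the
average, and its quartic term falls below the average by a quarter of `∫ (|u|² - |v|²)²`. So
non-negative `u`, `v` whose average energy is close to the minimal energy at their average mass have
close densities, and since `(a - b)⁴ ≤ (a² - b²)²` for `a, b ≥ 0` they are close in `L⁴`
(`quarticNorm_sub_le_energy`). With equality of energies this is uniqueness.

The same estimate gives existence and continuity without a compact embedding. For non-negative
states with mass tending to `M` and energy tending to `minEnergy M`, the differences tend to zero in
`L⁴`; bounded moments turn this into `L²` smallness (`mass_le_interpolation`). Hence the linear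
midpoints also have mass tending to `M`, and the parallelogram law bounds the gradient and moment of
the differences by a vanishing energy defect (`gradSq_add_momentSq_sub_le`). The sequence is Cauchy
and its limit is a ground state (`exists_energyTendsto_isGroundState`). Continuity of `minEnergy`,
used throughout, comes from scaling `u` by a constant.

For arbitrary minimisers the energy convergence is continuity of `minEnergy`; for the pumping, pass
to the modulus `meanState u u`, a ground state with the same pumping.

Two analytic facts support this. A weak derivative in `L²` exists with norm at most `K` exactly when
translations are `K`-Lipschitz in `L²`, so pointwise Lipschitz operations such as the quadratic mean
need no chain rule. And `|u|²` has translations Lipschitz in `L¹`, so the planar Sobolev inequality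
puts it in `L²`, that is `u ∈ L⁴`. -/

/-! ### Translations, weak derivatives and difference quotients -/

/-- The `i`-th coordinate vector of the plane. -/
noncomputable def coordVec (i : Fin 2) : Plane := EuclideanSpace.single i 1

theorem norm_coordVec (i : Fin 2) : ‖coordVec i‖ = 1 := by
  simp [coordVec]

/-- Translation of square-integrable functions, `x ↦ u (x + a)`. -/
noncomputable def shift (a : Plane) : L2 →ₗᵢ[ℂ] L2 :=
  Lp.compMeasurePreservingₗᵢ ℂ (fun x => x + a) (measurePreserving_add_right volume a)

theorem coeFn_shift (a : Plane) (u : L2) : shift a u =ᵐ[volume] fun x => u (x + a) :=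
  Lp.coeFn_compMeasurePreserving u (measurePreserving_add_right volume a)

theorem ae_comp_add_right {p : Plane → Prop} (h : ∀ᵐ x, p x) (a : Plane) : ∀ᵐ x, p (x + a) :=
  (measurePreserving_add_right volume a).quasiMeasurePreserving.ae h

theorem shift_shift (a b : Plane) (u : L2) : shift a (shift b u) = shift (a + b) u := by
  refine Lp.ext ?_
  filter_upwards [coeFn_shift a (shift b u), coeFn_shift (a + b) u,
    ae_comp_add_right (coeFn_shift b u) a] with x h1 h2 h3
  rw [h1, h2, h3, add_assoc]

theorem shift_zero (u : L2) : shift 0 u = u := by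
  refine Lp.ext ?_
  filter_upwards [coeFn_shift 0 u] with x h1
  rw [h1, add_zero]

theorem memLp_ofReal {φ : Plane → ℝ} (h : Continuous φ) (hc : HasCompactSupport φ) :
    MemLp (fun x => (φ x : ℂ)) 2 (volume : Measure Plane) :=
  (h.memLp_of_hasCompactSupport hc).ofReal

/-- The class in `L²` of a real continuous function of compact support. -/
noncomputable def testLp (φ : Plane → ℝ) (h : Continuous φ) (hc : HasCompactSupport φ) : L2 :=
  (memLp_ofReal h hc).toLp _

theorem inner_testLp {φ : Plane → ℝ} (h : Continuous φ) (hc : HasCompactSupport φ) (u : L2) :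
    inner ℂ (testLp φ h hc) u = ∫ x, φ x • u x := by
  rw [L2.inner_def]
  refine integral_congr_ae ?_
  filter_upwards [(memLp_ofReal h hc).coeFn_toLp] with x hx
  rw [testLp, hx]
  simp [mul_comm]

/-- Classes of real test functions. -/
def testSet : Set L2 :=
  {f | ∃ (φ : Plane → ℝ) (h : ContDiff ℝ ∞ φ) (hc : HasCompactSupport φ),
    f = testLp φ h.continuous hc}

theorem span_testSet_topologicalClosure :
    (Submodule.span ℂ testSet).topologicalClosure = ⊤ := by
  rw [Submodule.topologicalClosure_eq_top_iff, Submodule.eq_bot_iff]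
  intro v hv
  refine Lp.ext ?_
  refine ae_eq_of_integral_contDiff_smul_eq ((Lp.memLp v).locallyIntegrable (by norm_num))
    ((Lp.memLp (0 : L2)).locallyIntegrable (by norm_num)) fun φ hφ hc => ?_
  rw [← inner_testLp hφ.continuous hc, ← inner_testLp hφ.continuous hc, inner_zero_right]
  exact (Submodule.mem_orthogonal _ _).1 hv _ (Submodule.subset_span ⟨φ, hφ, hc, rfl⟩)

/-- Norms can be tested on a dense subspace: the bound passes to the closure, and then `f = d` is
admissible. -/
theorem norm_le_of_inner_span {d : L2} {C : ℝ} (hC : 0 ≤ C)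
    (h : ∀ f ∈ Submodule.span ℂ testSet, ‖inner ℂ f d‖ ≤ C * ‖f‖) : ‖d‖ ≤ C := by
  have hcl : IsClosed {f : L2 | ‖inner ℂ f d‖ ≤ C * ‖f‖} :=
    isClosed_le (by fun_prop) (by fun_prop)
  have hd : d ∈ closure (Submodule.span ℂ testSet : Set L2) := by
    rw [← Submodule.topologicalClosure_coe, span_testSet_topologicalClosure]
    trivial
  have h1 : ‖inner ℂ d d‖ ≤ C * ‖d‖ := closure_minimal h hcl hd
  rw [inner_self_eq_norm_sq_to_K] at h1
  simp only [norm_pow, RCLike.norm_ofReal, abs_norm] at h1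
  rcases (norm_nonneg d).eq_or_lt with h0 | h0
  · rwa [← h0]
  · nlinarith

theorem hasDerivAt_inner_testLp_shift_zero {φ : Plane → ℝ} (hφ : ContDiff ℝ ∞ φ)
    (hc : HasCompactSupport φ) (e : Plane) (u : L2) :
    HasDerivAt (fun s : ℝ => inner ℂ (testLp φ hφ.continuous hc) (shift (s • e) u))
      (- ∫ x, fderiv ℝ φ x e • u x) 0 := by
  have hu : LocallyIntegrable (fun x => u x) (volume : Measure Plane) :=
    (Lp.memLp u).locallyIntegrable (by norm_num)
  -- With the reflection `ψ`, the pairing of `φ` with the translate by `s • e` is the convolution of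
  -- `ψ` and `u` at `s • e`, which is differentiable because `ψ` is smooth.
  set ψ : Plane → ℝ := fun x => φ (-x) with hψdef
  have hψ : ContDiff ℝ ∞ ψ := hφ.comp contDiff_neg
  have hψc : HasCompactSupport ψ := hc.comp_homeomorph (Homeomorph.neg Plane)
  have hψ1 : ContDiff ℝ 1 ψ := hψ.of_le (by simp)
  have hψd : ∀ y, fderiv ℝ ψ y e = - fderiv ℝ φ (-y) e := fun y => by
    have h1 := ((hφ.differentiable (by simp)) (-y)).hasFDerivAt.comp y (hasFDerivAt_id y).neg
    change fderiv ℝ (φ ∘ fun x => -x) y e = _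
    rw [HasFDerivAt.fderiv (f := φ ∘ fun x => -x) h1]
    simp
  have key := hψc.hasFDerivAt_convolution_left (ContinuousLinearMap.lsmul ℝ ℝ) hψ1 hu 0
  have hlin : HasDerivAt (fun s : ℝ => s • e) e 0 := by
    simpa using (hasDerivAt_id (0 : ℝ)).smul_const e
  rw [show (0 : Plane) = (0 : ℝ) • e by simp] at key
  have key2 := key.comp_hasDerivAt (0 : ℝ) hlin
  have hfun : (fun s : ℝ => inner ℂ (testLp φ hφ.continuous hc) (shift (s • e) u)) =
      (convolution ψ (fun x => u x) (ContinuousLinearMap.lsmul ℝ ℝ) volume) ∘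
        fun s : ℝ => s • e := by
    funext s
    simp only [Function.comp]
    rw [inner_testLp, convolution_eq_swap]
    simp only [ContinuousLinearMap.lsmul_apply, hψdef]
    rw [← integral_add_right_eq_self (fun x => φ (-(s • e - x)) • u x) (s • e)]
    refine integral_congr_ae ?_
    filter_upwards [coeFn_shift (s • e) u] with x hx
    rw [hx]
    congr 2
    abel
  have hval : (convolution (fderiv ℝ ψ) (fun x => u x)
      (ContinuousLinearMap.precompL Plane (ContinuousLinearMap.lsmul ℝ ℝ)) volume
        ((0 : ℝ) • e)) e = - ∫ x, fderiv ℝ φ x e • u x := by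
    rw [convolution_eq_swap, ContinuousLinearMap.integral_apply, ← integral_neg]
    · refine integral_congr_ae (Eventually.of_forall fun x => ?_)
      simp [ContinuousLinearMap.precompL_apply, hψd]
    · have := (hψc.fderiv (𝕜 := ℝ)).convolutionExists_left
        (ContinuousLinearMap.precompL Plane (ContinuousLinearMap.lsmul ℝ ℝ : ℝ →L[ℝ] ℂ →L[ℝ] ℂ))
        (hψ1.continuous_fderiv (by simp)) hu ((0 : ℝ) • e)
      exact this.integrable_swap
  rw [hfun, ← hval]
  exact key2

theorem hasDerivAt_inner_testLp_shift {φ : Plane → ℝ} (hφ : ContDiff ℝ ∞ φ)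
    (hc : HasCompactSupport φ) (e : Plane) (u : L2) (t : ℝ) :
    HasDerivAt (fun s : ℝ => inner ℂ (testLp φ hφ.continuous hc) (shift (s • e) u))
      (- ∫ x, fderiv ℝ φ x e • (shift (t • e) u) x) t := by
  have h := hasDerivAt_inner_testLp_shift_zero hφ hc e (shift (t • e) u)
  rw [← sub_self t] at h
  have h2 := h.comp_sub_const t t
  refine h2.congr_of_eventuallyEq (Eventually.of_forall fun s => ?_)
  simp only [shift_shift, ← add_smul, sub_add_cancel]

theorem isWeakPartial_iff {i : Fin 2} {u g : L2} : IsWeakPartial i u g ↔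
    ∀ (φ : Plane → ℝ) (hφ : ContDiff ℝ ∞ φ) (hc : HasCompactSupport φ),
      - ∫ x, fderiv ℝ φ x (coordVec i) • u x = inner ℂ (testLp φ hφ.continuous hc) g := by
  refine forall_congr' fun φ => forall_congr' fun hφ => forall_congr' fun hc => ?_
  rw [inner_testLp, neg_eq_iff_eq_neg]
  rfl

theorem inner_testLp_shift {φ : Plane → ℝ} (h : Continuous φ) (hc : HasCompactSupport φ)
    (a : Plane) (u : L2) : inner ℂ (testLp φ h hc) (shift a u) = ∫ x, φ (x - a) • u x := by
  rw [inner_testLp, ← integral_add_right_eq_self (fun x => φ (x - a) • u x) a]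
  refine integral_congr_ae ?_
  filter_upwards [coeFn_shift a u] with x hx
  rw [hx, add_sub_cancel_right]

theorem IsWeakPartial.shift {i : Fin 2} {u g : L2} (h : IsWeakPartial i u g) (a : Plane) :
    IsWeakPartial i (shift a u) (shift a g) := by
  rw [isWeakPartial_iff]
  intro φ hφ hc
  have hc' : HasCompactSupport fun x => φ (x - a) := hc.comp_homeomorph (Homeomorph.subRight a)
  have hφ' : ContDiff ℝ ∞ fun x => φ (x - a) := hφ.comp (contDiff_id.sub contDiff_const)
  have hd := inner_testLp_shift (continuous_partial hφ (coordVec i))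
    (hasCompactSupport_partial hc (coordVec i)) a u
  have h1 := isWeakPartial_iff.1 h _ hφ' hc'
  rw [inner_testLp] at hd h1
  rw [inner_testLp_shift, ← h1, hd]
  simp [fderiv_comp_sub]

/-- Tested against a fixed `f`, the translate of `u` has derivative the pairing of `f` with the
translate of `g`, bounded by `‖f‖ * ‖g‖`; the mean value inequality concludes. -/
theorem IsWeakPartial.norm_shift_sub_le {i : Fin 2} {u g : L2} (h : IsWeakPartial i u g) (t : ℝ) :
    ‖_root_.shift (t • coordVec i) u - u‖ ≤ ‖g‖ * |t| := by
  refine norm_le_of_inner_span (by positivity) fun f hf => ?_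
  have hder : ∀ s : ℝ, HasDerivAt (fun s : ℝ => inner ℂ f (_root_.shift (s • coordVec i) u))
      (inner ℂ f (_root_.shift (s • coordVec i) g)) s := by
    intro s
    induction hf using Submodule.span_induction with
    | mem f hf =>
      obtain ⟨φ, hφ, hc, rfl⟩ := hf
      rw [← isWeakPartial_iff.1 (h.shift (s • coordVec i)) φ hφ hc]
      exact hasDerivAt_inner_testLp_shift hφ hc _ u s
    | zero => simpa using hasDerivAt_const s (0 : ℂ)
    | add f k _ _ hf hk =>
      simp only [inner_add_left]
      exact hf.add hk
    | smul c f _ hf => simpa [inner_smul_left] using hf.const_mul (starRingEnd ℂ c)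
  have hb := Convex.norm_image_sub_le_of_norm_hasDerivWithin_le (s := univ) (x := 0) (y := t)
    (C := ‖f‖ * ‖g‖) (fun s _ => (hder s).hasDerivWithinAt)
    (fun s _ => by
      simpa using norm_inner_le_norm (𝕜 := ℂ) f (_root_.shift (s • coordVec i) g))
    convex_univ trivial trivial
  simp only [zero_smul, shift_zero, sub_zero, Real.norm_eq_abs] at hb
  rw [inner_sub_right]
  calc _ ≤ _ := hb
    _ = _ := by ring

/-- Banach–Alaoglu through the Riesz isometry; an ultrafilter takes the place of a subsequence. -/
theorem exists_weak_limit {ι : Type*} (l : Filter ι) [l.NeBot] (d : ι → L2) {K : ℝ}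
    (hd : ∀ n, ‖d n‖ ≤ K) : ∃ (U : Ultrafilter ι) (g : L2), ↑U ≤ l ∧ ‖g‖ ≤ K ∧
      ∀ f, Tendsto (fun n => inner ℂ (d n) f) U (𝓝 (inner ℂ g f)) := by
  have hcomp := WeakDual.isCompact_closedBall (0 : StrongDual ℂ L2) K
  have hmem : ∀ n, StrongDual.toWeakDual (InnerProductSpace.toDual ℂ L2 (d n)) ∈
      WeakDual.toStrongDual ⁻¹' Metric.closedBall (0 : StrongDual ℂ L2) K := fun n => by
    simpa using hd n
  obtain ⟨T, hT, hle⟩ := hcomp.ultrafilter_le_nhds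
    ((Ultrafilter.of l).map fun n => StrongDual.toWeakDual (InnerProductSpace.toDual ℂ L2 (d n)))
    (by
      rw [le_principal_iff]
      exact Filter.mem_map.2 (Eventually.of_forall hmem))
  refine ⟨Ultrafilter.of l, (InnerProductSpace.toDual ℂ L2).symm (WeakDual.toStrongDual T),
    Ultrafilter.of_le l, ?_, fun f => ?_⟩
  · simpa using hT
  · have h1 := ((WeakDual.eval_continuous f).tendsto T).comp hle
    rw [InnerProductSpace.toDual_symm_apply]
    exact h1

/-- The difference quotients are bounded by `K`; a weak limit of them is the derivative, because the
pairings with test functions are differentiable at `0`. -/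
theorem exists_isWeakPartial_of_shift {i : Fin 2} {u : L2} {K : ℝ}
    (h : ∀ t : ℝ, ‖shift (t • coordVec i) u - u‖ ≤ K * |t|) :
    ∃ g, IsWeakPartial i u g ∧ ‖g‖ ≤ K := by
  have hne : (𝓝[≠] (0 : ℝ)).NeBot := inferInstance
  have hK : 0 ≤ K := by
    have := (norm_nonneg _).trans (h 1)
    simpa using this
  obtain ⟨U, g, hU, hg, hlim⟩ := exists_weak_limit (𝓝[≠] (0 : ℝ))
    (fun t : ℝ => (t : ℂ)⁻¹ • (shift (t • coordVec i) u - u)) (K := K) fun t => by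
      rw [norm_smul, norm_inv, Complex.norm_real, Real.norm_eq_abs]
      rcases eq_or_ne t 0 with rfl | ht
      · simpa using hK
      · rw [inv_mul_le_iff₀ (abs_pos.2 ht), mul_comm]
        exact h t
  refine ⟨g, isWeakPartial_iff.2 fun φ hφ hc => ?_, hg⟩
  have h1 := (hasDerivAt_iff_tendsto_slope.1
    (hasDerivAt_inner_testLp_shift_zero hφ hc (coordVec i) u)).mono_left hU
  have h2 := (Complex.continuous_conj.tendsto _).comp (hlim (testLp φ hφ.continuous hc))
  simp only [Function.comp_def, inner_conj_symm] at h2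
  refine tendsto_nhds_unique h1 (h2.congr fun t => ?_)
  simp [slope_def_module, inner_smul_right, shift_zero, inner_sub_right]

/-! ### Translation bounds in `L¹` and the embedding into `L⁴` -/

/-- Translations of `f` in the coordinate directions are `K`-Lipschitz in `L¹`, as they are for
functions of bounded variation. -/
def HasTranslationBound (f : Plane → ℝ) (K : ℝ≥0∞) : Prop :=
  ∀ (i : Fin 2) (t : ℝ), ∫⁻ x, ‖f (x + t • coordVec i) - f x‖ₑ ≤ ‖t‖ₑ * K

theorem enorm_clm_le (L : Plane →L[ℝ] ℝ) : ‖L‖ₑ ≤ ‖L (coordVec 0)‖ₑ + ‖L (coordVec 1)‖ₑ := by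
  have h : ‖L‖ ≤ ‖L (coordVec 0)‖ + ‖L (coordVec 1)‖ := by
    refine L.opNorm_le_bound (by positivity) fun v => ?_
    have hv : v = v 0 • coordVec 0 + v 1 • coordVec 1 := by
      ext i
      fin_cases i <;> simp [coordVec]
    have h0 : ‖v 0‖ ≤ ‖v‖ := PiLp.norm_apply_le v 0
    have h1 : ‖v 1‖ ≤ ‖v‖ := PiLp.norm_apply_le v 1
    calc ‖L v‖ = ‖v 0 • L (coordVec 0) + v 1 • L (coordVec 1)‖ := by
          conv_lhs => rw [hv]
          simp
      _ ≤ ‖v 0‖ * ‖L (coordVec 0)‖ + ‖v 1‖ * ‖L (coordVec 1)‖ := by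
          refine (norm_add_le _ _).trans ?_
          rw [norm_smul, norm_smul]
      _ ≤ ‖v‖ * ‖L (coordVec 0)‖ + ‖v‖ * ‖L (coordVec 1)‖ := by gcongr
      _ = _ := by ring
  rw [← ofReal_norm, ← ofReal_norm, ← ofReal_norm, ← ENNReal.ofReal_add (by positivity)
    (by positivity)]
  exact ENNReal.ofReal_le_ofReal h

/-- Fatou's lemma applied to difference quotients. -/
theorem HasTranslationBound.lintegral_partial_le {F : Plane → ℝ} {K : ℝ≥0∞}
    (h : HasTranslationBound F K) (hF : ContDiff ℝ 1 F) (i : Fin 2) :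
    ∫⁻ x, ‖fderiv ℝ F x (coordVec i)‖ₑ ≤ K := by
  set t : ℕ → ℝ := fun n => ((n : ℝ) + 1)⁻¹ with ht
  have htpos : ∀ n, 0 < t n := fun n => by positivity
  have ht0 : Tendsto t atTop (𝓝[≠] 0) := by
    rw [tendsto_nhdsWithin_iff]
    refine ⟨?_, Eventually.of_forall fun n => (htpos n).ne'⟩
    simpa [ht] using tendsto_one_div_add_atTop_nhds_zero_nat (𝕜 := ℝ)
  have hlim : ∀ x, Tendsto (fun n => ‖(t n)⁻¹ • (F (x + t n • coordVec i) - F x)‖ₑ) atTop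
      (𝓝 ‖fderiv ℝ F x (coordVec i)‖ₑ) := by
    intro x
    have hd := ((hF.differentiable (by simp)) x).hasFDerivAt.hasLineDerivAt (coordVec i)
    have h2 := hd.tendsto_slope_zero
    exact (h2.comp ht0).enorm
  have hbound : ∀ n, ∫⁻ x, ‖(t n)⁻¹ • (F (x + t n • coordVec i) - F x)‖ₑ ≤ K := by
    intro n
    simp only [enorm_smul]
    rw [lintegral_const_mul' _ _ (by simp)]
    calc _ ≤ ‖(t n)⁻¹‖ₑ * (‖t n‖ₑ * K) := by gcongr; exact h i (t n)
      _ = K := by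
        rw [← mul_assoc, ← enorm_mul, inv_mul_cancel₀ (htpos n).ne']
        simp
  calc ∫⁻ x, ‖fderiv ℝ F x (coordVec i)‖ₑ
      = ∫⁻ x, liminf (fun n => ‖(t n)⁻¹ • (F (x + t n • coordVec i) - F x)‖ₑ) atTop :=
        lintegral_congr fun x => (hlim x).liminf_eq.symm
    _ ≤ liminf (fun n => ∫⁻ x, ‖(t n)⁻¹ • (F (x + t n • coordVec i) - F x)‖ₑ) atTop :=
        lintegral_liminf_le fun n => by
          have := hF.continuous
          fun_prop
    _ ≤ liminf (fun _ : ℕ => K) atTop := liminf_le_liminf (Eventually.of_forall hbound)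
    _ = K := by simp

theorem HasTranslationBound.lintegral_sq_le_of_contDiff {F : Plane → ℝ} {K : ℝ≥0∞}
    (h : HasTranslationBound F K) (hF : ContDiff ℝ 1 F) (hc : HasCompactSupport F) :
    ∫⁻ x, ‖F x‖ₑ ^ 2 ≤ lintegralPowLePowLIntegralFDerivConst (volume : Measure Plane) 2 *
      (K + K) ^ 2 := by
  -- In dimension two the Gagliardo–Nirenberg–Sobolev exponent is its own conjugate.
  have hp : Real.HolderConjugate (Module.finrank ℝ Plane) 2 := by
    simpa using Real.HolderConjugate.two_two
  have h1 := lintegral_pow_le_pow_lintegral_fderiv (volume : Measure Plane) hF hc hp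
  simp only [ENNReal.rpow_ofNat] at h1
  refine h1.trans ?_
  gcongr
  calc ∫⁻ x, ‖fderiv ℝ F x‖ₑ
      ≤ ∫⁻ x, (‖fderiv ℝ F x (coordVec 0)‖ₑ + ‖fderiv ℝ F x (coordVec 1)‖ₑ) :=
        lintegral_mono fun x => enorm_clm_le _
    _ = (∫⁻ x, ‖fderiv ℝ F x (coordVec 0)‖ₑ) + ∫⁻ x, ‖fderiv ℝ F x (coordVec 1)‖ₑ := by
        refine lintegral_add_left ?_ _
        exact ((hF.continuous_fderiv (by simp)).clm_apply continuous_const).measurable.enorm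
    _ ≤ K + K := add_le_add (h.lintegral_partial_le hF 0) (h.lintegral_partial_le hF 1)

/-- Averaging translates of `f` against a probability density cannot increase the bound. -/
theorem HasTranslationBound.mollify {f : Plane → ℝ} {K : ℝ≥0∞} (h : HasTranslationBound f K)
    (hm : Measurable f) (hf : Integrable f) (η : ContDiffBump (0 : Plane)) :
    HasTranslationBound
      (convolution (η.normed volume) f (ContinuousLinearMap.lsmul ℝ ℝ) volume) K := by
  intro i t
  set a := t • coordVec i
  set ρ : Plane → ℝ := η.normed volume with hρ
  have hρc : Continuous ρ := η.continuous_normed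
  have hex : ConvolutionExists ρ f (ContinuousLinearMap.lsmul ℝ ℝ) volume :=
    η.hasCompactSupport_normed.convolutionExists_left _ hρc hf.locallyIntegrable
  have hone : ∫⁻ s, ‖ρ s‖ₑ = 1 := by
    have h1 := η.integral_normed (μ := volume)
    rw [← ofReal_integral_norm_eq_lintegral_enorm η.integrable_normed]
    have : ∀ s, ‖η.normed volume s‖ = η.normed volume s := fun s =>
      Real.norm_of_nonneg (η.nonneg_normed s)
    simp [this, h1]
  calc ∫⁻ x, ‖convolution ρ f (ContinuousLinearMap.lsmul ℝ ℝ) volume (x + a) -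
        convolution ρ f (ContinuousLinearMap.lsmul ℝ ℝ) volume x‖ₑ
      ≤ ∫⁻ x, ∫⁻ s, ‖ρ s‖ₑ * ‖f (x - s + a) - f (x - s)‖ₑ := by
        refine lintegral_mono fun x => ?_
        rw [convolution_def, convolution_def, ← integral_sub (hex (x + a)) (hex x)]
        refine (enorm_integral_le_lintegral_enorm _).trans (le_of_eq ?_)
        refine lintegral_congr fun s => ?_
        simp only [ContinuousLinearMap.lsmul_apply]
        rw [← smul_sub, enorm_smul, sub_add_eq_add_sub]
    _ = ∫⁻ s, ∫⁻ x, ‖ρ s‖ₑ * ‖f (x - s + a) - f (x - s)‖ₑ := by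
        refine lintegral_lintegral_swap ?_
        have := hρc.measurable
        fun_prop
    _ = ∫⁻ s, ‖ρ s‖ₑ * ∫⁻ x, ‖f (x + a) - f x‖ₑ := by
        refine lintegral_congr fun s => ?_
        rw [lintegral_const_mul' _ _ (by simp)]
        congr 1
        exact lintegral_sub_right_eq_self (fun x => ‖f (x + a) - f x‖ₑ) s
    _ = ∫⁻ x, ‖f (x + a) - f x‖ₑ := by
        rw [lintegral_mul_const _ hρc.measurable.enorm, hone, one_mul]
    _ ≤ _ := h i t

theorem HasTranslationBound.lintegral_sq_le_of_hasCompactSupport {f : Plane → ℝ} {K : ℝ≥0∞}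
    (h : HasTranslationBound f K) (hm : Measurable f) (hf : Integrable f)
    (hc : HasCompactSupport f) :
    ∫⁻ x, ‖f x‖ₑ ^ 2 ≤ lintegralPowLePowLIntegralFDerivConst (volume : Measure Plane) 2 *
      (K + K) ^ 2 := by
  -- The ratio of outer to inner radius stays equal to 2, as almost everywhere convergence of the
  -- mollifications requires.
  let η : ℕ → ContDiffBump (0 : Plane) := fun n =>
    { rIn := ((n : ℝ) + 1)⁻¹
      rOut := 2 * ((n : ℝ) + 1)⁻¹
      rIn_pos := by positivity
      rIn_lt_rOut := by
        have : 0 < ((n : ℝ) + 1)⁻¹ := by positivity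
        linarith }
  have hη0 : Tendsto (fun n => (η n).rOut) atTop (𝓝 0) := by
    have := (tendsto_one_div_add_atTop_nhds_zero_nat (𝕜 := ℝ)).const_mul 2
    simpa [η] using this
  set F : ℕ → Plane → ℝ := fun n =>
    convolution ((η n).normed volume) f (ContinuousLinearMap.lsmul ℝ ℝ) volume with hF
  have hFs : ∀ n, ContDiff ℝ 1 (F n) := fun n =>
    (η n).hasCompactSupport_normed.contDiff_convolution_left _ (η n).contDiff_normed
      hf.locallyIntegrable
  have hFc : ∀ n, HasCompactSupport (F n) := fun n =>
    HasCompactSupport.convolution _ (η n).hasCompactSupport_normed hc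
  have hlim : ∀ᵐ x, Tendsto (fun n => F n x) atTop (𝓝 (f x)) :=
    ContDiffBump.ae_convolution_tendsto_right_of_locallyIntegrable hη0
      (Eventually.of_forall fun n => le_rfl) hf.locallyIntegrable
  calc ∫⁻ x, ‖f x‖ₑ ^ 2 = ∫⁻ x, liminf (fun n => ‖F n x‖ₑ ^ 2) atTop := by
        refine lintegral_congr_ae ?_
        filter_upwards [hlim] with x hx
        exact (((ENNReal.continuous_pow 2).tendsto _).comp hx.enorm).liminf_eq.symm
    _ ≤ liminf (fun n => ∫⁻ x, ‖F n x‖ₑ ^ 2) atTop :=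
        lintegral_liminf_le fun n => ((hFs n).continuous.measurable.enorm.pow_const 2)
    _ ≤ liminf (fun _ : ℕ => lintegralPowLePowLIntegralFDerivConst (volume : Measure Plane) 2 *
      (K + K) ^ 2) atTop := liminf_le_liminf (Eventually.of_forall fun n =>
        (h.mollify hm hf (η n)).lintegral_sq_le_of_contDiff (hFs n) (hFc n))
    _ = _ := by simp

/-- A Lipschitz cut-off, equal to `1` on the ball of radius `R`. -/
noncomputable def cutoff (R : ℝ) (x : Plane) : ℝ := max 0 (min 1 (R + 1 - ‖x‖))

theorem cutoff_nonneg (R : ℝ) (x : Plane) : 0 ≤ cutoff R x := le_max_left _ _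

theorem cutoff_le_one (R : ℝ) (x : Plane) : cutoff R x ≤ 1 :=
  max_le zero_le_one (min_le_left _ _)

theorem cutoff_eq_one {R : ℝ} {x : Plane} (h : ‖x‖ ≤ R) : cutoff R x = 1 := by
  rw [cutoff, min_eq_left (by linarith), max_eq_right zero_le_one]

theorem continuous_cutoff (R : ℝ) : Continuous (cutoff R) := by
  unfold cutoff
  fun_prop

theorem hasCompactSupport_cutoff (R : ℝ) : HasCompactSupport (cutoff R) := by
  refine HasCompactSupport.intro (isCompact_closedBall 0 (R + 1)) fun x hx => ?_
  simp only [Metric.mem_closedBall, dist_zero_right, not_le] at hx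
  rw [cutoff, max_eq_left]
  exact (min_le_right _ _).trans (by linarith)

theorem abs_cutoff_sub_le (R : ℝ) (x y : Plane) : |cutoff R x - cutoff R y| ≤ ‖x - y‖ := by
  have h := abs_le.1 (abs_norm_sub_norm_le x y)
  have h0 := norm_nonneg (x - y)
  simp only [cutoff, max_def, min_def]
  rw [abs_le]
  split_ifs <;> constructor <;> linarith

theorem HasTranslationBound.cutoff {f : Plane → ℝ} {K : ℝ≥0∞} (h : HasTranslationBound f K)
    (hm : Measurable f) (R : ℝ) :
    HasTranslationBound (fun x => cutoff R x * f x) (K + ∫⁻ x, ‖f x‖ₑ) := by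
  intro i t
  calc ∫⁻ x, ‖_root_.cutoff R (x + t • coordVec i) * f (x + t • coordVec i)
        - _root_.cutoff R x * f x‖ₑ
      ≤ ∫⁻ x, (‖f (x + t • coordVec i) - f x‖ₑ + ‖t‖ₑ * ‖f x‖ₑ) := by
        refine lintegral_mono fun x => ?_
        set y := x + t • coordVec i with hy
        have h1 : _root_.cutoff R y * f y - _root_.cutoff R x * f x =
          _root_.cutoff R y * (f y - f x) + (_root_.cutoff R y - _root_.cutoff R x) * f x := by ring
        rw [h1]
        refine (enorm_add_le _ _).trans ?_
        rw [enorm_mul, enorm_mul]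
        have h2 : ‖_root_.cutoff R y‖ₑ ≤ 1 := by
          rw [← enorm_one (G := ℝ), enorm_le_iff_norm_le]
          simpa [abs_of_nonneg (cutoff_nonneg R y)] using cutoff_le_one R y
        have h3 : ‖_root_.cutoff R y - _root_.cutoff R x‖ₑ ≤ ‖t‖ₑ := by
          rw [enorm_le_iff_norm_le]
          refine (abs_cutoff_sub_le R y x).trans ?_
          simp [hy, norm_smul, norm_coordVec]
        gcongr
        simpa using mul_le_mul_left h2 ‖f y - f x‖ₑ
    _ = (∫⁻ x, ‖f (x + t • coordVec i) - f x‖ₑ) + ‖t‖ₑ * ∫⁻ x, ‖f x‖ₑ := by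
        rw [lintegral_add_left (by fun_prop), lintegral_const_mul' _ _ (by simp)]
    _ ≤ _ := by
        rw [mul_add]
        gcongr
        exact h i t

/-- The cut-offs are all 1-Lipschitz, so the truncations satisfy one bound independent of the
radius, and Fatou's lemma removes the truncation. -/
theorem HasTranslationBound.lintegral_sq_lt_top {f : Plane → ℝ} {K : ℝ≥0∞}
    (h : HasTranslationBound f K) (hK : K ≠ ⊤) (hm : Measurable f) (hf : Integrable f) :
    ∫⁻ x, ‖f x‖ₑ ^ 2 < (⊤ : ℝ≥0∞) := by
  set K' := K + ∫⁻ x, ‖f x‖ₑ with hK'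
  have hK'top : K' ≠ ⊤ := ENNReal.add_ne_top.2 ⟨hK, hf.2.ne⟩
  have hb : ∀ n : ℕ, ∫⁻ x, ‖_root_.cutoff n x * f x‖ₑ ^ 2 ≤
      lintegralPowLePowLIntegralFDerivConst (volume : Measure Plane) 2 * (K' + K') ^ 2 := fun n =>
    (h.cutoff hm n).lintegral_sq_le_of_hasCompactSupport
      ((continuous_cutoff n).measurable.mul hm)
      (hf.bdd_mul (c := 1) (continuous_cutoff n).aestronglyMeasurable
        (Eventually.of_forall fun x => by
          simpa [abs_of_nonneg (cutoff_nonneg n x)] using cutoff_le_one n x))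
      (hasCompactSupport_cutoff n).mul_right
  have hlim : ∀ x, Tendsto (fun n : ℕ => ‖_root_.cutoff n x * f x‖ₑ ^ 2) atTop
      (𝓝 (‖f x‖ₑ ^ 2)) := by
    intro x
    refine tendsto_const_nhds.congr' ?_
    filter_upwards [eventually_ge_atTop ⌈‖x‖⌉₊] with n hn
    rw [cutoff_eq_one (Nat.ceil_le.1 hn), one_mul]
  calc ∫⁻ x, ‖f x‖ₑ ^ 2 = ∫⁻ x, liminf (fun n : ℕ => ‖_root_.cutoff n x * f x‖ₑ ^ 2) atTop :=
        lintegral_congr fun x => (hlim x).liminf_eq.symm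
    _ ≤ liminf (fun n : ℕ => ∫⁻ x, ‖_root_.cutoff n x * f x‖ₑ ^ 2) atTop :=
        lintegral_liminf_le fun n =>
          (((continuous_cutoff n).measurable.mul hm).enorm.pow_const 2)
    _ ≤ liminf (fun _ : ℕ => lintegralPowLePowLIntegralFDerivConst (volume : Measure Plane) 2 *
      (K' + K') ^ 2) atTop := liminf_le_liminf (Eventually.of_forall hb)
    _ = lintegralPowLePowLIntegralFDerivConst (volume : Measure Plane) 2 * (K' + K') ^ 2 := by simp
    _ < ⊤ := by
      refine ENNReal.mul_lt_top ENNReal.coe_lt_top (ENNReal.pow_lt_top ?_)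
      exact ENNReal.add_lt_top.2 ⟨hK'top.lt_top, hK'top.lt_top⟩

/-- From `||a|² - |b|²| ≤ (|a| + |b|) |a - b|` and Cauchy–Schwarz. Summing over the directions makes
the constant independent of `i`. -/
theorem hasTranslationBound_normSq {u : L2} {g : Fin 2 → L2}
    (h : ∀ i, IsWeakPartial i u (g i)) :
    HasTranslationBound (fun x => ‖u x‖ ^ 2) ((∑ i, ‖g i‖ₑ) * (‖u‖ₑ + ‖u‖ₑ)) := by
  intro i t
  set a := t • coordVec i with ha
  have hmp := measurePreserving_add_right (volume : Measure Plane) a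
  have hum : AEStronglyMeasurable (fun x => ‖u x‖) (volume : Measure Plane) :=
    (Lp.aestronglyMeasurable u).norm
  have hum' : AEStronglyMeasurable (fun x => ‖u (x + a)‖) (volume : Measure Plane) :=
    hum.comp_measurePreserving hmp
  have hd : eLpNorm (fun x => u (x + a) - u x) 2 volume ≤ ‖t‖ₑ * ∑ i, ‖g i‖ₑ := by
    have h1 : eLpNorm (fun x => u (x + a) - u x) 2 volume = ‖shift a u - u‖ₑ := by
      rw [Lp.enorm_def]
      refine eLpNorm_congr_ae ?_
      filter_upwards [coeFn_shift a u, Lp.coeFn_sub (shift a u) u] with x h1 h2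
      rw [h2, Pi.sub_apply, h1]
    rw [h1]
    calc _ ≤ ‖t‖ₑ * ‖g i‖ₑ := by
          rw [← ofReal_norm, ← ofReal_norm, ← ofReal_norm,
            ← ENNReal.ofReal_mul (norm_nonneg _), mul_comm]
          exact ENNReal.ofReal_le_ofReal ((h i).norm_shift_sub_le t)
      _ ≤ _ := by
          gcongr
          exact Finset.single_le_sum (f := fun i => ‖g i‖ₑ) (fun _ _ => bot_le)
            (Finset.mem_univ i)
  have hs : eLpNorm (fun x => ‖u (x + a)‖ + ‖u x‖) 2 volume ≤ ‖u‖ₑ + ‖u‖ₑ := by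
    refine (eLpNorm_add_le hum' hum (by norm_num)).trans (le_of_eq ?_)
    rw [eLpNorm_norm, Lp.enorm_def]
    congr 1
    · exact eLpNorm_comp_measurePreserving (Lp.aestronglyMeasurable u) hmp
    · exact eLpNorm_norm u
  calc ∫⁻ x, ‖‖u (x + a)‖ ^ 2 - ‖u x‖ ^ 2‖ₑ
      ≤ ∫⁻ x, ‖(‖u (x + a)‖ + ‖u x‖) • (u (x + a) - u x)‖ₑ := by
        refine lintegral_mono fun x => ?_
        rw [enorm_le_iff_norm_le, norm_smul, sq_sub_sq, norm_mul]
        gcongr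
        exact abs_norm_sub_norm_le _ _
    _ = eLpNorm ((fun x => (‖u (x + a)‖ + ‖u x‖)) • fun x => (u (x + a) - u x)) 1 volume := by
        rw [eLpNorm_one_eq_lintegral_enorm]; rfl
    _ ≤ eLpNorm (fun x => (‖u (x + a)‖ + ‖u x‖)) 2 volume *
        eLpNorm (fun x => (u (x + a) - u x)) 2 volume :=
        eLpNorm_smul_le_mul_eLpNorm
          (((Lp.aestronglyMeasurable u).comp_measurePreserving hmp).sub
            (Lp.aestronglyMeasurable u)) (hum'.add hum)
    _ ≤ (‖u‖ₑ + ‖u‖ₑ) * (‖t‖ₑ * ∑ i, ‖g i‖ₑ) := by gcongr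
    _ = _ := by ring

theorem memLp_four_of_isWeakPartial {u : L2} {g : Fin 2 → L2}
    (h : ∀ i, IsWeakPartial i u (g i)) : MemLp (fun x => u x) 4 volume := by
  refine ⟨Lp.aestronglyMeasurable u, ?_⟩
  have h1 := (hasTranslationBound_normSq h).lintegral_sq_lt_top
    (ENNReal.mul_ne_top (by simp) (by simp))
    ((Lp.stronglyMeasurable u).norm.measurable.pow_const 2)
    ((Lp.memLp u).integrable_norm_pow (by norm_num))
  rw [eLpNorm_lt_top_iff_lintegral_rpow_enorm_lt_top (by norm_num) (by norm_num)]
  refine lt_of_eq_of_lt (lintegral_congr fun x => ?_) h1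
  rw [enorm_pow, enorm_norm, ← pow_mul]
  norm_num

/-! ### Scaling, parallelogram laws and midpoint convexity -/

theorem weakPartial_spec (i : Fin 2) (u : energySpace) : IsWeakPartial i u (weakPartial i u) :=
  (u.2.1 i).choose_spec

theorem weakPartial_eq {i : Fin 2} {u : energySpace} {g : L2} (h : IsWeakPartial i u g) :
    weakPartial i u = g :=
  (weakPartial_spec i u).unique h

theorem weakPartial_add (i : Fin 2) (u v : energySpace) :
    weakPartial i (u + v) = weakPartial i u + weakPartial i v :=
  weakPartial_eq ((weakPartial_spec i u).add (weakPartial_spec i v))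

theorem weakPartial_smul (i : Fin 2) (c : ℂ) (u : energySpace) :
    weakPartial i (c • u) = c • weakPartial i u :=
  weakPartial_eq ((weakPartial_spec i u).smul c)

theorem weakPartial_sub (i : Fin 2) (u v : energySpace) :
    weakPartial i (u - v) = weakPartial i u - weakPartial i v := by
  rw [sub_eq_add_neg, ← neg_one_smul ℂ v, weakPartial_add, weakPartial_smul, neg_one_smul,
    ← sub_eq_add_neg]

theorem coeFn_add (u v : energySpace) :
    ∀ᵐ x : Plane, ((u + v : energySpace) : L2) x = (u : L2) x + (v : L2) x :=
  Lp.coeFn_add (u : L2) v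

theorem coeFn_sub (u v : energySpace) :
    ∀ᵐ x : Plane, ((u - v : energySpace) : L2) x = (u : L2) x - (v : L2) x :=
  Lp.coeFn_sub (u : L2) v

theorem coeFn_smul (c : ℂ) (u : energySpace) :
    ∀ᵐ x : Plane, ((c • u : energySpace) : L2) x = c * (u : L2) x :=
  Lp.coeFn_smul c (u : L2)

theorem memLp_four (u : energySpace) : MemLp (fun x => (u : L2) x) 4 volume :=
  memLp_four_of_isWeakPartial fun i => weakPartial_spec i u

theorem integrable_sq (u : L2) : Integrable (fun x => ‖u x‖ ^ 2) :=
  (Lp.memLp u).integrable_norm_pow (by norm_num)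

theorem integrable_moment (u : energySpace) :
    Integrable (fun x : Plane => ‖x‖ ^ 2 * ‖(u : L2) x‖ ^ 2) := by
  have h := u.2.2.integrable_norm_pow (by norm_num)
  refine h.congr (Eventually.of_forall fun x => ?_)
  simp [mul_pow]

theorem integrable_four (u : energySpace) : Integrable (fun x : Plane => ‖(u : L2) x‖ ^ 4) :=
  (memLp_four u).integrable_norm_pow (by norm_num)

theorem norm_sq_eq_integral (u : L2) : ‖u‖ ^ 2 = ∫ x, ‖u x‖ ^ 2 := by
  have h := inner_self_eq_norm_sq_to_K (𝕜 := ℂ) u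
  rw [L2.inner_def] at h
  simp only [inner_self_eq_norm_sq_to_K] at h
  have h2 : (∫ x, ((‖u x‖ ^ 2 : ℝ) : ℂ)) = ((‖u‖ ^ 2 : ℝ) : ℂ) := by
    simpa using h
  rw [integral_complex_ofReal] at h2
  exact_mod_cast h2.symm

theorem mass_eq_integral (u : energySpace) : mass u = ∫ x, ‖(u : L2) x‖ ^ 2 :=
  norm_sq_eq_integral u

theorem mass_nonneg (u : energySpace) : 0 ≤ mass u := sq_nonneg _

theorem gradSq_nonneg (u : energySpace) : 0 ≤ gradSq u :=
  Finset.sum_nonneg fun _ _ => sq_nonneg _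

theorem momentSq_nonneg (u : energySpace) : 0 ≤ momentSq u :=
  integral_nonneg fun _ => by positivity

theorem quarticNorm_nonneg (u : energySpace) : 0 ≤ quarticNorm u :=
  integral_nonneg fun _ => by positivity

theorem hamiltonian_nonneg (u : energySpace) : 0 ≤ hamiltonian u := by
  have := gradSq_nonneg u
  have := momentSq_nonneg u
  have := quarticNorm_nonneg u
  unfold hamiltonian
  positivity

theorem mass_smul (c : ℂ) (u : energySpace) : mass (c • u) = ‖c‖ ^ 2 * mass u := by
  simp [mass, norm_smul, mul_pow]

theorem gradSq_smul (c : ℂ) (u : energySpace) : gradSq (c • u) = ‖c‖ ^ 2 * gradSq u := by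
  simp only [gradSq, weakPartial_smul, norm_smul, mul_pow, Finset.mul_sum]

theorem momentSq_smul (c : ℂ) (u : energySpace) : momentSq (c • u) = ‖c‖ ^ 2 * momentSq u := by
  rw [momentSq, momentSq, ← integral_const_mul]
  refine integral_congr_ae ?_
  filter_upwards [coeFn_smul c u] with x hx
  rw [hx, norm_mul]
  ring

theorem quarticNorm_smul (c : ℂ) (u : energySpace) :
    quarticNorm (c • u) = ‖c‖ ^ 4 * quarticNorm u := by
  rw [quarticNorm, quarticNorm, ← integral_const_mul]
  refine integral_congr_ae ?_
  filter_upwards [coeFn_smul c u] with x hx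
  rw [hx, norm_mul]
  ring

theorem mass_parallelogram (u v : energySpace) :
    mass (u + v) + mass (u - v) = 2 * (mass u + mass v) := by
  simp only [mass, Submodule.coe_add, Submodule.coe_sub]
  exact parallelogram_law_with_norm ℂ (u : L2) v

theorem gradSq_parallelogram (u v : energySpace) :
    gradSq (u + v) + gradSq (u - v) = 2 * (gradSq u + gradSq v) := by
  simp only [gradSq, weakPartial_add, weakPartial_sub, ← Finset.sum_add_distrib, Finset.mul_sum]
  exact Finset.sum_congr rfl fun i _ => parallelogram_law_with_norm ℂ _ _

theorem momentSq_parallelogram (u v : energySpace) :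
    momentSq (u + v) + momentSq (u - v) = 2 * (momentSq u + momentSq v) := by
  simp only [momentSq]
  rw [← integral_add (integrable_moment _) (integrable_moment _),
    ← integral_add (integrable_moment _) (integrable_moment _), ← integral_const_mul]
  refine integral_congr_ae ?_
  filter_upwards [coeFn_add u v, coeFn_sub u v] with x h1 h2
  rw [h1, h2]
  have := parallelogram_law_with_norm ℂ ((u : L2) x) ((v : L2) x)
  linear_combination ‖x‖ ^ 2 * this

theorem quarticNorm_add_le (u v : energySpace) :
    quarticNorm (u + v) ≤ 8 * (quarticNorm u + quarticNorm v) := by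
  simp only [quarticNorm]
  rw [← integral_add (integrable_four _) (integrable_four _), ← integral_const_mul]
  refine integral_mono_ae (integrable_four _)
    (((integrable_four _).add (integrable_four _)).const_mul _) ?_
  filter_upwards [coeFn_add u v] with x h1
  rw [h1]
  have h2 := norm_add_le ((u : L2) x) ((v : L2) x)
  have h3 := pow_le_pow_left₀ (norm_nonneg _) h2 4
  refine h3.trans ?_
  have := add_pow_le (norm_nonneg ((u : L2) x)) (norm_nonneg ((v : L2) x)) 4
  norm_num at this ⊢
  exact this

/-- The midpoint convexity of the Hamiltonian controls the quadratic part of a difference. -/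
theorem gradSq_add_momentSq_sub_le (u v : energySpace) :
    gradSq (u - v) + momentSq (u - v) ≤
      8 * ((hamiltonian u + hamiltonian v) / 2 - hamiltonian ((1 / 2 : ℂ) • (u + v))) := by
  -- By the parallelogram law the quadratic part of the defect is exactly one eighth of the left
  -- side; the quartic part is non-negative.
  have h1 := gradSq_parallelogram u v
  have h2 := momentSq_parallelogram u v
  have h3 := quarticNorm_add_le u v
  simp only [hamiltonian, gradSq_smul, momentSq_smul, quarticNorm_smul]
  norm_num
  linarith

/-! ### The quadratic mean and convexity in the density -/

/-- Reverse triangle inequality for the Euclidean norm of the plane divided by `√2`. -/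
theorem sqrt_mean_sub_sq_le (p q r s : ℝ) :
    (√((p ^ 2 + q ^ 2) / 2) - √((r ^ 2 + s ^ 2) / 2)) ^ 2 ≤ ((p - r) ^ 2 + (q - s) ^ 2) / 2 := by
  have h1 : (p * r + q * s) / 2 ≤ √((p ^ 2 + q ^ 2) / 2) * √((r ^ 2 + s ^ 2) / 2) := by
    rw [← Real.sqrt_mul (by positivity)]
    refine Real.le_sqrt_of_sq_le ?_
    nlinarith [sq_nonneg (p * s - q * r)]
  have h2 := Real.sq_sqrt (show 0 ≤ (p ^ 2 + q ^ 2) / 2 by positivity)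
  have h3 := Real.sq_sqrt (show 0 ≤ (r ^ 2 + s ^ 2) / 2 by positivity)
  nlinarith

/-- The quadratic mean of the moduli of two square-integrable functions. -/
noncomputable def quadMeanFun (u v : L2) (x : Plane) : ℂ := (√((‖u x‖ ^ 2 + ‖v x‖ ^ 2) / 2) : ℝ)

theorem norm_quadMeanFun_sq (u v : L2) (x : Plane) :
    ‖quadMeanFun u v x‖ ^ 2 = (‖u x‖ ^ 2 + ‖v x‖ ^ 2) / 2 := by
  rw [quadMeanFun, Complex.norm_real, Real.norm_eq_abs, sq_abs, Real.sq_sqrt (by positivity)]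

theorem aestronglyMeasurable_quadMeanFun (u v : L2) :
    AEStronglyMeasurable (quadMeanFun u v) volume := by
  have hu := (Lp.stronglyMeasurable u).norm.measurable
  have hv := (Lp.stronglyMeasurable v).norm.measurable
  unfold quadMeanFun
  exact (Complex.measurable_ofReal.comp
    ((((hu.pow_const 2).add (hv.pow_const 2)).div_const 2).sqrt)).aestronglyMeasurable

theorem memLp_quadMeanFun (u v : L2) : MemLp (quadMeanFun u v) 2 volume := by
  rw [memLp_two_iff_integrable_sq_norm (aestronglyMeasurable_quadMeanFun u v)]
  simp only [norm_quadMeanFun_sq]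
  exact ((integrable_sq u).add (integrable_sq v)).div_const 2

/-- The class of the quadratic mean `√((|u|² + |v|²) / 2)`. -/
noncomputable def quadMean (u v : L2) : L2 := (memLp_quadMeanFun u v).toLp _

theorem coeFn_quadMean (u v : L2) : quadMean u v =ᵐ[volume] quadMeanFun u v :=
  (memLp_quadMeanFun u v).coeFn_toLp

theorem norm_shift_quadMean_sub_sq_le (u v : L2) (a : Plane) :
    ‖shift a (quadMean u v) - quadMean u v‖ ^ 2 ≤
      (‖shift a u - u‖ ^ 2 + ‖shift a v - v‖ ^ 2) / 2 := by
  rw [norm_sq_eq_integral, norm_sq_eq_integral (shift a u - u),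
    norm_sq_eq_integral (shift a v - v), ← integral_add (integrable_sq _) (integrable_sq _),
    ← integral_div]
  refine integral_mono_ae (integrable_sq _)
    (((integrable_sq _).add (integrable_sq _)).div_const 2) ?_
  filter_upwards [coeFn_shift a u, coeFn_shift a v, coeFn_shift a (quadMean u v),
    coeFn_quadMean u v, ae_comp_add_right (coeFn_quadMean u v) a, Lp.coeFn_sub (shift a u) u,
    Lp.coeFn_sub (shift a v) v, Lp.coeFn_sub (shift a (quadMean u v)) (quadMean u v)]
    with x h1 h2 h3 h4 h5 h6 h7 h8
  rw [h6, h7, h8]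
  simp only [Pi.sub_apply]
  rw [h1, h2, h3, h4, h5]
  unfold quadMeanFun
  rw [← Complex.ofReal_sub, Complex.norm_real, Real.norm_eq_abs, sq_abs]
  refine (sqrt_mean_sub_sq_le _ _ _ _).trans ?_
  have hk : ∀ a b : ℂ, (‖a‖ - ‖b‖) ^ 2 ≤ ‖a - b‖ ^ 2 := fun a b => by
    rw [sq_le_sq, abs_norm]
    exact abs_norm_sub_norm_le a b
  have := hk (u (x + a)) (u x)
  have := hk (v (x + a)) (v x)
  linarith

theorem exists_isWeakPartial_quadMean {i : Fin 2} {u v g k : L2} (hu : IsWeakPartial i u g)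
    (hv : IsWeakPartial i v k) :
    ∃ m, IsWeakPartial i (quadMean u v) m ∧ ‖m‖ ^ 2 ≤ (‖g‖ ^ 2 + ‖k‖ ^ 2) / 2 := by
  obtain ⟨m, hm, hm2⟩ := exists_isWeakPartial_of_shift (i := i) (u := quadMean u v)
    (K := √((‖g‖ ^ 2 + ‖k‖ ^ 2) / 2)) fun t => by
      refine abs_le_of_sq_le_sq' ?_ (by positivity) |>.2
      rw [mul_pow, Real.sq_sqrt (by positivity)]
      refine (norm_shift_quadMean_sub_sq_le u v _).trans ?_
      have h1 := pow_le_pow_left₀ (norm_nonneg _) (hu.norm_shift_sub_le t) 2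
      have h2 := pow_le_pow_left₀ (norm_nonneg _) (hv.norm_shift_sub_le t) 2
      rw [mul_pow] at h1 h2
      linarith
  refine ⟨m, hm, ?_⟩
  have := pow_le_pow_left₀ (norm_nonneg _) hm2 2
  rwa [Real.sq_sqrt (by positivity)] at this

theorem quadMean_mem (u v : energySpace) : quadMean u v ∈ energySpace := by
  refine ⟨fun i => ?_, ?_⟩
  · obtain ⟨m, hm, -⟩ := exists_isWeakPartial_quadMean (weakPartial_spec i u) (weakPartial_spec i v)
    exact ⟨m, hm⟩
  · have hm : AEStronglyMeasurable (fun x : Plane => (‖x‖ : ℂ) * quadMean u v x) volume :=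
      (Complex.continuous_ofReal.comp continuous_norm).aestronglyMeasurable.mul
        (Lp.aestronglyMeasurable _)
    rw [memLp_two_iff_integrable_sq_norm hm]
    refine (((integrable_moment u).add (integrable_moment v)).div_const 2).congr ?_
    filter_upwards [coeFn_quadMean u v] with x hx
    rw [norm_mul, mul_pow, hx, norm_quadMeanFun_sq]
    simp
    ring

/-- The quadratic mean as an element of the energy space. -/
noncomputable def meanState (u v : energySpace) : energySpace := ⟨quadMean u v, quadMean_mem u v⟩

theorem coeFn_meanState (u v : energySpace) :
    ∀ᵐ x : Plane, (meanState u v : L2) x = quadMeanFun u v x :=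
  coeFn_quadMean u v

theorem norm_meanState_sq (u v : energySpace) :
    ∀ᵐ x : Plane, ‖(meanState u v : L2) x‖ ^ 2 = (‖(u : L2) x‖ ^ 2 + ‖(v : L2) x‖ ^ 2) / 2 := by
  filter_upwards [coeFn_meanState u v] with x hx
  rw [hx, norm_quadMeanFun_sq]

theorem meanState_nonneg (u v : energySpace) :
    ∀ᵐ x : Plane, (meanState u v : L2) x = (‖(meanState u v : L2) x‖ : ℂ) := by
  filter_upwards [coeFn_meanState u v] with x hx
  rw [hx, quadMeanFun, Complex.norm_real, Real.norm_of_nonneg (Real.sqrt_nonneg _)]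

theorem mass_meanState (u v : energySpace) : mass (meanState u v) = (mass u + mass v) / 2 := by
  rw [mass_eq_integral, mass_eq_integral, mass_eq_integral,
    ← integral_add (integrable_sq _) (integrable_sq _), ← integral_div]
  exact integral_congr_ae (norm_meanState_sq u v)

theorem momentSq_meanState (u v : energySpace) :
    momentSq (meanState u v) = (momentSq u + momentSq v) / 2 := by
  rw [momentSq, momentSq, momentSq,
    ← integral_add (integrable_moment _) (integrable_moment _), ← integral_div]
  refine integral_congr_ae ?_
  filter_upwards [norm_meanState_sq u v] with x hx
  rw [hx]
  ring

theorem gradSq_meanState_le (u v : energySpace) :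
    gradSq (meanState u v) ≤ (gradSq u + gradSq v) / 2 := by
  rw [gradSq, gradSq, gradSq, ← Finset.sum_add_distrib, Finset.sum_div]
  refine Finset.sum_le_sum fun i _ => ?_
  obtain ⟨m, hm, hm2⟩ := exists_isWeakPartial_quadMean (weakPartial_spec i u) (weakPartial_spec i v)
  rwa [weakPartial_eq (u := meanState u v) hm]

/-- With `a`, `b` the densities, `(a - b)² = 2 (a² + b²) - 4 ((a + b) / 2)²`, and each term is a
fourth power of a state. -/
theorem integrable_density_sub_sq (u v : energySpace) :
    Integrable (fun x : Plane => (‖(u : L2) x‖ ^ 2 - ‖(v : L2) x‖ ^ 2) ^ 2) := by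
  have h := (((integrable_four u).add (integrable_four v)).const_mul 2).sub
    ((integrable_four (meanState u v)).const_mul 4)
  refine h.congr ?_
  filter_upwards [norm_meanState_sq u v] with x hx
  simp only [Pi.sub_apply, Pi.add_apply]
  rw [show ‖(meanState u v : L2) x‖ ^ 4 = (‖(meanState u v : L2) x‖ ^ 2) ^ 2 by ring, hx]
  ring

theorem quarticNorm_meanState (u v : energySpace) :
    quarticNorm (meanState u v) = (quarticNorm u + quarticNorm v) / 2 -
      (1 / 4) * ∫ x : Plane, (‖(u : L2) x‖ ^ 2 - ‖(v : L2) x‖ ^ 2) ^ 2 := by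
  rw [quarticNorm, quarticNorm, quarticNorm, ← integral_add (integrable_four _) (integrable_four _),
    ← integral_div, ← integral_const_mul]
  refine Eq.trans ?_ (integral_sub (((integrable_four u).add (integrable_four v)).div_const 2)
    ((integrable_density_sub_sq u v).const_mul _))
  refine integral_congr_ae ?_
  filter_upwards [norm_meanState_sq u v] with x hx
  rw [show ‖(meanState u v : L2) x‖ ^ 4 = (‖(meanState u v : L2) x‖ ^ 2) ^ 2 by ring, hx]
  ring

/-- Strict convexity of the Hamiltonian as a function of the density. -/
theorem hamiltonian_meanState_le (u v : energySpace) :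
    hamiltonian (meanState u v) ≤ (hamiltonian u + hamiltonian v) / 2 -
      (1 / 16) * ∫ x : Plane, (‖(u : L2) x‖ ^ 2 - ‖(v : L2) x‖ ^ 2) ^ 2 := by
  have := gradSq_meanState_le u v
  simp only [hamiltonian, momentSq_meanState, quarticNorm_meanState]
  linarith

/-- The property of being real and non-negative almost everywhere. -/
def IsNonneg (u : energySpace) : Prop := ∀ᵐ x : Plane, (u : L2) x = (‖(u : L2) x‖ : ℂ)

theorem quarticNorm_sub_le {u v : energySpace} (hu : IsNonneg u) (hv : IsNonneg v) :
    quarticNorm (u - v) ≤ ∫ x : Plane, (‖(u : L2) x‖ ^ 2 - ‖(v : L2) x‖ ^ 2) ^ 2 := by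
  refine integral_mono_ae (integrable_four _) (integrable_density_sub_sq u v) ?_
  filter_upwards [hu, hv, coeFn_sub u v] with x h1 h2 h3
  have h4 : (u : L2) x - (v : L2) x = ((‖(u : L2) x‖ - ‖(v : L2) x‖ : ℝ) : ℂ) := by
    rw [Complex.ofReal_sub, ← h1, ← h2]
  rw [h3, h4, Complex.norm_real, Real.norm_eq_abs, Even.pow_abs (by decide)]
  have hp := norm_nonneg ((u : L2) x)
  have hq := norm_nonneg ((v : L2) x)
  calc (‖(u : L2) x‖ - ‖(v : L2) x‖) ^ 4
      = (‖(u : L2) x‖ - ‖(v : L2) x‖) ^ 2 * (‖(u : L2) x‖ - ‖(v : L2) x‖) ^ 2 := by ring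
    _ ≤ (‖(u : L2) x‖ - ‖(v : L2) x‖) ^ 2 * (‖(u : L2) x‖ + ‖(v : L2) x‖) ^ 2 := by
        gcongr ?_ * ?_
        nlinarith [mul_nonneg hp hq]
    _ = _ := by ring

/-! ### The minimal energy and its continuity in the mass -/

theorem bddBelow_hamiltonian (s : Set energySpace) : BddBelow (hamiltonian '' s) :=
  ⟨0, by rintro _ ⟨u, -, rfl⟩; exact hamiltonian_nonneg u⟩

theorem minEnergy_le {M : ℝ} {u : energySpace} (h : mass u = M) : minEnergy M ≤ hamiltonian u :=
  csInf_le (bddBelow_hamiltonian _) ⟨u, h, rfl⟩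

theorem minEnergy_nonneg (M : ℝ) : 0 ≤ minEnergy M :=
  Real.sInf_nonneg (by rintro _ ⟨u, -, rfl⟩; exact hamiltonian_nonneg u)

theorem isWeakPartial_testLp {φ : Plane → ℝ} (hφ : ContDiff ℝ ∞ φ) (hc : HasCompactSupport φ)
    (i : Fin 2) : IsWeakPartial i (testLp φ hφ.continuous hc)
      (testLp _ (continuous_partial hφ (coordVec i)) (hasCompactSupport_partial hc (coordVec i))) := by
  intro ψ hψ hψc
  have hcψ := continuous_partial hψ (coordVec i)
  have hcφ := continuous_partial hφ (coordVec i)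
  have h := integral_mul_fderiv_eq_neg_fderiv_mul_of_integrable (μ := (volume : Measure Plane))
    (f := φ) (g := ψ) (v := coordVec i)
    ((hcφ.mul hψ.continuous).integrable_of_hasCompactSupport hψc.mul_left)
    ((hφ.continuous.mul hcψ).integrable_of_hasCompactSupport hc.mul_right)
    ((hφ.continuous.mul hψ.continuous).integrable_of_hasCompactSupport hψc.mul_left)
    (fun x _ => hφ.differentiable (by simp) x) (fun x _ => hψ.differentiable (by simp) x)
  have h1 : ∀ (f k : Plane → ℝ) (hk : Continuous k) (hkc : HasCompactSupport k),
      ∫ x, f x • (testLp k hk hkc) x = ((∫ x, k x * f x : ℝ) : ℂ) := by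
    intro f k hk hkc
    rw [← integral_complex_ofReal]
    refine integral_congr_ae ?_
    filter_upwards [(memLp_ofReal hk hkc).coeFn_toLp] with x hx
    rw [testLp, hx]
    simp [mul_comm]
  change ∫ x, (fderiv ℝ ψ x (coordVec i)) • _ = _
  rw [h1 (fun x => fderiv ℝ ψ x (coordVec i)), h1, h, Complex.ofReal_neg]

theorem testLp_mem {φ : Plane → ℝ} (hφ : ContDiff ℝ ∞ φ) (hc : HasCompactSupport φ) :
    testLp φ hφ.continuous hc ∈ energySpace := by
  refine ⟨fun i => ⟨_, isWeakPartial_testLp hφ hc i⟩, ?_⟩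
  have h : MemLp (fun x : Plane => ((‖x‖ * φ x : ℝ) : ℂ)) 2 volume :=
    memLp_ofReal (continuous_norm.mul hφ.continuous) hc.mul_left
  refine h.ae_eq ?_
  filter_upwards [(memLp_ofReal hφ.continuous hc).coeFn_toLp] with x hx
  rw [testLp, hx, Complex.ofReal_mul]

/-- Supplies competitors at every positive mass after scaling, so that the infimum is not the
default value on the empty set. -/
theorem exists_mass_pos : ∃ u : energySpace, 0 < mass u := by
  let η : ContDiffBump (0 : Plane) := ⟨1, 2, one_pos, one_lt_two⟩
  have hφ : ContDiff ℝ ∞ η := η.contDiff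
  refine ⟨⟨_, testLp_mem hφ η.hasCompactSupport⟩, ?_⟩
  refine pow_pos (norm_pos_iff.2 fun h0 => ?_) 2
  have h1 := (memLp_ofReal hφ.continuous η.hasCompactSupport).coeFn_toLp
  have h2 : ∀ᵐ x : Plane, (η x : ℂ) = 0 := by
    have h3 := Lp.coeFn_zero ℂ 2 (volume : Measure Plane)
    rw [← h0] at h3
    filter_upwards [h1, h3] with x h4 h5
    rw [← h4]
    exact h5
  have h3 : (fun x : Plane => (η x : ℂ)) = fun _ => 0 :=
    (Continuous.ae_eq_iff_eq (volume : Measure Plane) (Complex.continuous_ofReal.comp η.continuous)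
      continuous_const).1 h2
  have h4 := congrFun h3 0
  have h5 : η 0 = 1 := η.one_of_mem_closedBall (by simp [η])
  simp [h5] at h4

theorem exists_mass_eq {M : ℝ} (hM : 0 < M) : ∃ u : energySpace, mass u = M := by
  obtain ⟨u, hu⟩ := exists_mass_pos
  refine ⟨((√(M / mass u) : ℝ) : ℂ) • u, ?_⟩
  rw [mass_smul, Complex.norm_real, Real.norm_eq_abs, sq_abs, Real.sq_sqrt (by positivity)]
  field_simp

/-- Scaling by `√(N / M)` multiplies the quadratic part by `N / M` and the quartic part by its
square. Used both ways, it squeezes `minEnergy`. -/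
theorem minEnergy_le_mul {M N : ℝ} (hM : 0 < M) (hN : 0 < N) :
    minEnergy N ≤ max (N / M) ((N / M) ^ 2) * minEnergy M := by
  set r := N / M with hr
  have hr0 : 0 < r := div_pos hN hM
  have hmax : 0 < max r (r ^ 2) := lt_max_of_lt_left hr0
  rw [← div_le_iff₀' hmax]
  obtain ⟨u₀, hu₀⟩ := exists_mass_eq hM
  refine le_csInf ⟨_, u₀, hu₀, rfl⟩ ?_
  rintro _ ⟨u, hu, rfl⟩
  rw [div_le_iff₀' hmax]
  have hc : ‖((√r : ℝ) : ℂ)‖ ^ 2 = r := by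
    rw [Complex.norm_real, Real.norm_eq_abs, sq_abs, Real.sq_sqrt hr0.le]
  have hc4 : ‖((√r : ℝ) : ℂ)‖ ^ 4 = r ^ 2 := by
    rw [show (4 : ℕ) = 2 * 2 from rfl, pow_mul, hc]
  have hu' : mass u = M := hu
  refine (minEnergy_le (u := ((√r : ℝ) : ℂ) • u) ?_).trans ?_
  · rw [mass_smul, hc, hu', hr]
    field_simp
  · simp only [hamiltonian, gradSq_smul, momentSq_smul, quarticNorm_smul, hc, hc4]
    have h1 := mul_le_mul_of_nonneg_right (le_max_left r (r ^ 2))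
      (add_nonneg (gradSq_nonneg u) (momentSq_nonneg u))
    have h2 := mul_le_mul_of_nonneg_right (le_max_right r (r ^ 2)) (quarticNorm_nonneg u)
    linarith

theorem continuousAt_minEnergy {M : ℝ} (hM : 0 < M) : ContinuousAt minEnergy M := by
  have h1 : Tendsto (fun N : ℝ => N / M) (𝓝 M) (𝓝 1) := by
    simpa [hM.ne'] using (tendsto_id (α := ℝ) (x := 𝓝 M)).div_const M
  have h2 : Tendsto (fun N : ℝ => M / N) (𝓝 M) (𝓝 1) := by
    have h := (tendsto_const_nhds (x := M)).div (tendsto_id (α := ℝ) (x := 𝓝 M)) hM.ne'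
    rwa [div_self hM.ne'] at h
  have hmax : ∀ {f : ℝ → ℝ}, Tendsto f (𝓝 M) (𝓝 1) →
      Tendsto (fun N => max (f N) (f N ^ 2)) (𝓝 M) (𝓝 1) := fun h => by
    simpa using h.max (h.pow 2)
  have hlow : Tendsto (fun N => minEnergy M / max (M / N) ((M / N) ^ 2)) (𝓝 M)
      (𝓝 (minEnergy M)) := by
    have h := (tendsto_const_nhds (x := minEnergy M)).div (hmax h2) one_ne_zero
    rwa [div_one] at h
  have hupp : Tendsto (fun N => max (N / M) ((N / M) ^ 2) * minEnergy M) (𝓝 M)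
      (𝓝 (minEnergy M)) := by
    simpa using (hmax h1).mul_const (minEnergy M)
  refine tendsto_of_tendsto_of_tendsto_of_le_of_le' hlow hupp ?_ ?_
  · filter_upwards [eventually_gt_nhds hM] with N hN
    rw [div_le_iff₀' (lt_max_of_lt_left (div_pos hM hN))]
    exact minEnergy_le_mul hN hM
  · filter_upwards [eventually_gt_nhds hM] with N hN
    exact minEnergy_le_mul hM hN

theorem continuousOn_minEnergy : ContinuousOn minEnergy (Ioi 0) := fun _ hM =>
  (continuousAt_minEnergy hM).continuousWithinAt

theorem isMinimizer_iff {M : ℝ} {u : energySpace} :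
    IsMinimizer M u ↔ mass u = M ∧ hamiltonian u = minEnergy M := by
  refine and_congr_right fun hu => ⟨fun h => ?_, fun h w hw => h ▸ minEnergy_le hw⟩
  refine le_antisymm (le_csInf ⟨_, u, hu, rfl⟩ ?_) (minEnergy_le hu)
  rintro _ ⟨w, hw, rfl⟩
  exact h w hw

/-! ### Energy defect, uniqueness and the modulus of a minimiser -/

/-- The quadratic mean is a competitor at the average mass. -/
theorem quarticNorm_sub_le_energy {u v : energySpace} (hu : IsNonneg u) (hv : IsNonneg v) :
    quarticNorm (u - v) ≤
      16 * ((hamiltonian u + hamiltonian v) / 2 - minEnergy ((mass u + mass v) / 2)) := by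
  have h1 := quarticNorm_sub_le hu hv
  have h2 := hamiltonian_meanState_le u v
  have h3 := minEnergy_le (mass_meanState u v)
  linarith

theorem eq_of_quarticNorm_sub_nonpos {u v : energySpace} (h : quarticNorm (u - v) ≤ 0) :
    u = v := by
  have h0 : quarticNorm (u - v) = 0 := le_antisymm h (quarticNorm_nonneg _)
  rw [quarticNorm, integral_eq_zero_iff_of_nonneg (fun _ => by positivity) (integrable_four _)] at h0
  refine Subtype.ext (Lp.ext ?_)
  filter_upwards [h0, coeFn_sub u v] with x h1 h2
  rw [h2] at h1
  simpa [sub_eq_zero] using h1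

theorem IsGroundState.eq {M : ℝ} {u v : energySpace} (hu : IsGroundState M u)
    (hv : IsGroundState M v) : u = v := by
  refine eq_of_quarticNorm_sub_nonpos ((quarticNorm_sub_le_energy hu.2 hv.2).trans (le_of_eq ?_))
  obtain ⟨hu1, hu2⟩ := isMinimizer_iff.1 hu.1
  obtain ⟨hv1, hv2⟩ := isMinimizer_iff.1 hv.1
  rw [hu1, hv1, hu2, hv2]
  simp

theorem hamiltonian_meanState_self_le (u : energySpace) :
    hamiltonian (meanState u u) ≤ hamiltonian u := by
  have h := hamiltonian_meanState_le u u
  simpa using h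

theorem norm_meanState_self (u : energySpace) :
    ∀ᵐ x : Plane, ‖(meanState u u : L2) x‖ = ‖(u : L2) x‖ := by
  filter_upwards [norm_meanState_sq u u] with x hx
  rw [add_self_div_two] at hx
  exact (pow_left_inj₀ (norm_nonneg _) (norm_nonneg _) two_ne_zero).1 hx

theorem mass_meanState_self (u : energySpace) : mass (meanState u u) = mass u := by
  rw [mass_meanState, add_self_div_two]

/-- The modulus of a minimiser is a ground state. -/
theorem IsMinimizer.isGroundState_meanState {M : ℝ} {u : energySpace} (h : IsMinimizer M u) :
    IsGroundState M (meanState u u) :=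
  ⟨⟨(mass_meanState_self u).trans h.1, fun w hw =>
    (hamiltonian_meanState_self_le u).trans (h.2 w hw)⟩, meanState_nonneg u u⟩

/-- Interpolation of the mass between the quartic norm and the moment. -/
theorem mass_le_interpolation (u : energySpace) {R δ : ℝ} (hR : 0 < R) (hδ : 0 < δ) :
    mass u ≤ momentSq u / R ^ 2 + δ * volume.real (Metric.ball (0 : Plane) R) +
      quarticNorm u / δ := by
  have hball : IntegrableOn (fun _ : Plane => δ) (Metric.ball 0 R) :=
    integrableOn_const (by finiteness)
  have hind := hball.integrable_indicator measurableSet_ball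
  have h1 : ∫ x, (Metric.ball (0 : Plane) R).indicator (fun _ => δ) x =
      δ * volume.real (Metric.ball (0 : Plane) R) := by
    rw [integral_indicator measurableSet_ball, setIntegral_const, smul_eq_mul, mul_comm]
  have hm := (integrable_moment u).div_const (R ^ 2)
  have hq := (integrable_four u).div_const δ
  rw [mass_eq_integral, momentSq, quarticNorm, ← integral_div, ← integral_div, ← h1,
    ← integral_add hm hind]
  refine le_trans ?_ (integral_add (hm.add hind) hq).le
  refine integral_mono (integrable_sq _) ((hm.add hind).add hq) fun x => ?_
  simp only [Pi.add_apply]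
  set a := ‖(u : L2) x‖ ^ 2 with ha
  have ha0 : 0 ≤ a := sq_nonneg _
  have h4 : ‖(u : L2) x‖ ^ 4 = a ^ 2 := by rw [ha]; ring
  rw [h4]
  -- Inside the ball the density is at most `δ` or is absorbed by `a ^ 2 / δ`; outside, the weight
  -- `‖x‖² / R²` is at least one.
  by_cases hx : x ∈ Metric.ball (0 : Plane) R
  · rw [indicator_of_mem hx]
    have h5 : a ≤ δ + a ^ 2 / δ := by
      rw [← sub_le_iff_le_add', le_div_iff₀ hδ]
      nlinarith [sq_nonneg (a - δ)]
    have h6 : 0 ≤ ‖x‖ ^ 2 * a / R ^ 2 := by positivity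
    linarith
  · rw [indicator_of_notMem hx]
    have hx' : R ≤ ‖x‖ := by simpa using hx
    have h5 : a ≤ ‖x‖ ^ 2 * a / R ^ 2 := by
      rw [le_div_iff₀ (by positivity), mul_comm]
      gcongr
    have h6 : 0 ≤ a ^ 2 / δ := by positivity
    linarith

/-! ### Convergence and completeness in the energy space -/

instance : Fact ((1 : ℝ≥0∞) ≤ 4) := ⟨by norm_num⟩

/-- The weighted function `|x| u`, as a square-integrable function. -/
noncomputable def weighted (u : energySpace) : L2 := u.2.2.toLp _

/-- An element of the energy space as a class in `L⁴`. -/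
noncomputable def toL4 (u : energySpace) : Lp ℂ 4 (volume : Measure Plane) := (memLp_four u).toLp _

theorem coeFn_weighted (u : energySpace) :
    ∀ᵐ x : Plane, weighted u x = (‖x‖ : ℂ) * (u : L2) x :=
  u.2.2.coeFn_toLp

theorem coeFn_toL4 (u : energySpace) : ∀ᵐ x : Plane, toL4 u x = (u : L2) x :=
  (memLp_four u).coeFn_toLp

theorem weighted_sub (u v : energySpace) : weighted (u - v) = weighted u - weighted v := by
  refine Lp.ext ?_
  filter_upwards [coeFn_weighted u, coeFn_weighted v, coeFn_weighted (u - v), coeFn_sub u v,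
    Lp.coeFn_sub (weighted u) (weighted v)] with x h1 h2 h3 h4 h5
  rw [h5, Pi.sub_apply, h1, h2, h3, h4, mul_sub]

theorem toL4_sub (u v : energySpace) : toL4 (u - v) = toL4 u - toL4 v := by
  refine Lp.ext ?_
  filter_upwards [coeFn_toL4 u, coeFn_toL4 v, coeFn_toL4 (u - v), coeFn_sub u v,
    Lp.coeFn_sub (toL4 u) (toL4 v)] with x h1 h2 h3 h4 h5
  rw [h5, Pi.sub_apply, h1, h2, h3, h4]

theorem norm_weighted_sq (u : energySpace) : ‖weighted u‖ ^ 2 = momentSq u := by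
  rw [norm_sq_eq_integral, momentSq]
  refine integral_congr_ae ?_
  filter_upwards [coeFn_weighted u] with x hx
  rw [hx]
  simp [mul_pow]

theorem norm_toL4_pow (u : energySpace) : ‖toL4 u‖ ^ 4 = quarticNorm u := by
  rw [toL4, Lp.norm_toLp, (memLp_four u).eLpNorm_eq_integral_rpow_norm (by norm_num) (by norm_num),
    ENNReal.toReal_ofReal (by positivity), quarticNorm]
  simp only [ENNReal.toReal_ofNat, Real.rpow_ofNat]
  rw [← Real.rpow_natCast, ← Real.rpow_mul (integral_nonneg fun _ => by positivity)]
  norm_num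

theorem tendsto_zero_of_pow {ι : Type*} {l : Filter ι} {f : ι → ℝ} {k : ℕ} (hk : k ≠ 0)
    (hf : ∀ i, 0 ≤ f i) (h : Tendsto (fun i => f i ^ k) l (𝓝 0)) : Tendsto f l (𝓝 0) := by
  have h1 := h.rpow_const (p := ((k : ℝ)⁻¹)) (Or.inr (by positivity))
  rw [Real.zero_rpow (by positivity)] at h1
  exact h1.congr fun i => Real.pow_rpow_inv_natCast (hf i) hk

theorem cauchySeq_of_pow {E : Type*} [SeminormedAddCommGroup E] {f : ℕ → E} {k : ℕ} (hk : k ≠ 0)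
    (h : Tendsto (fun p : ℕ × ℕ => ‖f p.1 - f p.2‖ ^ k) atTop (𝓝 0)) : CauchySeq f := by
  rw [cauchySeq_iff_tendsto_dist_atTop_0]
  simp only [dist_eq_norm]
  exact tendsto_zero_of_pow hk (fun _ => norm_nonneg _) h

/-- Limits of a sequence and of its products with a fixed function correspond to each other. -/
theorem ae_eq_mul_of_tendsto {p q : ℝ≥0∞} [Fact (1 ≤ p)] [Fact (1 ≤ q)]
    {f : ℕ → Lp ℂ p (volume : Measure Plane)} {f' : Lp ℂ p (volume : Measure Plane)}
    {k : ℕ → Lp ℂ q (volume : Measure Plane)} {k' : Lp ℂ q (volume : Measure Plane)}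
    {c : Plane → ℂ} (hk : ∀ n, ∀ᵐ x, k n x = c x * f n x) (hf' : Tendsto f atTop (𝓝 f'))
    (hk' : Tendsto k atTop (𝓝 k')) : ∀ᵐ x, k' x = c x * f' x := by
  obtain ⟨φ, hφ, h1⟩ := (tendstoInMeasure_of_tendsto_Lp hf').exists_seq_tendsto_ae
  obtain ⟨ψ, hψ, h2⟩ := (tendstoInMeasure_of_tendsto_Lp
    (hk'.comp hφ.tendsto_atTop)).exists_seq_tendsto_ae
  filter_upwards [h1, h2, ae_all_iff.2 hk] with x hx1 hx2 hx3
  refine tendsto_nhds_unique hx2 (((hx1.comp hψ.tendsto_atTop).const_mul (c x)).congr fun n => ?_)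
  simp only [Function.comp, hx3]

theorem IsWeakPartial.of_tendsto {i : Fin 2} {u g : ℕ → L2} {u' g' : L2}
    (h : ∀ n, IsWeakPartial i (u n) (g n)) (hu : Tendsto u atTop (𝓝 u'))
    (hg : Tendsto g atTop (𝓝 g')) : IsWeakPartial i u' g' := by
  rw [isWeakPartial_iff]
  intro φ hφ hc
  have hd := continuous_partial hφ (coordVec i)
  have hdc := hasCompactSupport_partial hc (coordVec i)
  rw [← inner_testLp hd hdc]
  refine tendsto_nhds_unique
    (((continuous_const.inner continuous_id).tendsto u').comp hu).neg
    ((((continuous_const (y := testLp φ hφ.continuous hc)).inner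
      continuous_id).tendsto g').comp hg |>.congr fun n => ?_)
  simp only [Function.comp, id]
  rw [← isWeakPartial_iff.1 (h n) φ hφ hc, inner_testLp]

/-- Convergence in the energy space. -/
structure EnergyTendsto (f : ℕ → energySpace) (u : energySpace) : Prop where
  l2 : Tendsto (fun n => (f n : L2)) atTop (𝓝 u)
  grad : ∀ i, Tendsto (fun n => weakPartial i (f n)) atTop (𝓝 (weakPartial i u))
  weighted : Tendsto (fun n => weighted (f n)) atTop (𝓝 (weighted u))
  l4 : Tendsto (fun n => toL4 (f n)) atTop (𝓝 (toL4 u))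

theorem EnergyTendsto.tendsto_mass {f : ℕ → energySpace} {u : energySpace}
    (h : EnergyTendsto f u) : Tendsto (fun n => mass (f n)) atTop (𝓝 (mass u)) :=
  h.l2.norm.pow 2

theorem EnergyTendsto.tendsto_gradSq {f : ℕ → energySpace} {u : energySpace}
    (h : EnergyTendsto f u) : Tendsto (fun n => gradSq (f n)) atTop (𝓝 (gradSq u)) :=
  tendsto_finsetSum _ fun i _ => (h.grad i).norm.pow 2

theorem EnergyTendsto.tendsto_momentSq {f : ℕ → energySpace} {u : energySpace}
    (h : EnergyTendsto f u) : Tendsto (fun n => momentSq (f n)) atTop (𝓝 (momentSq u)) := by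
  simp only [← norm_weighted_sq]
  exact h.weighted.norm.pow 2

theorem EnergyTendsto.tendsto_quarticNorm {f : ℕ → energySpace} {u : energySpace}
    (h : EnergyTendsto f u) : Tendsto (fun n => quarticNorm (f n)) atTop (𝓝 (quarticNorm u)) := by
  simp only [← norm_toL4_pow]
  exact h.l4.norm.pow 4

theorem EnergyTendsto.tendsto_hamiltonian {f : ℕ → energySpace} {u : energySpace}
    (h : EnergyTendsto f u) : Tendsto (fun n => hamiltonian (f n)) atTop (𝓝 (hamiltonian u)) :=
  ((h.tendsto_gradSq.add h.tendsto_momentSq).const_mul _).add (h.tendsto_quarticNorm.const_mul _)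

theorem EnergyTendsto.tendsto_quarticNorm_sub {f : ℕ → energySpace} {u : energySpace}
    (h : EnergyTendsto f u) : Tendsto (fun n => quarticNorm (f n - u)) atTop (𝓝 0) := by
  simp only [← norm_toL4_pow, toL4_sub]
  simpa using (tendsto_iff_norm_sub_tendsto_zero.1 h.l4).pow 4

theorem EnergyTendsto.tendsto_sigmaNorm_sub {f : ℕ → energySpace} {u : energySpace}
    (h : EnergyTendsto f u) : Tendsto (fun n => sigmaNorm (f n - u)) atTop (𝓝 0) := by
  have h1 : Tendsto (fun n => gradSq (f n - u)) atTop (𝓝 0) := by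
    simp only [gradSq, weakPartial_sub]
    simpa using tendsto_finsetSum Finset.univ fun i _ =>
      (tendsto_iff_norm_sub_tendsto_zero.1 (h.grad i)).pow 2
  have h2 : Tendsto (fun n => momentSq (f n - u)) atTop (𝓝 0) := by
    simp only [← norm_weighted_sq, weighted_sub]
    simpa using (tendsto_iff_norm_sub_tendsto_zero.1 h.weighted).pow 2
  have h3 : Tendsto (fun n => mass (f n - u)) atTop (𝓝 0) := by
    simp only [mass, Submodule.coe_sub]
    simpa using (tendsto_iff_norm_sub_tendsto_zero.1 h.l2).pow 2
  simpa [sigmaNorm] using ((h1.add h2).add h3).sqrt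

theorem EnergyTendsto.isNonneg {f : ℕ → energySpace} {u : energySpace}
    (h : EnergyTendsto f u) (hf : ∀ n, IsNonneg (f n)) : IsNonneg u := by
  obtain ⟨φ, -, h1⟩ := (tendstoInMeasure_of_tendsto_Lp h.l2).exists_seq_tendsto_ae
  filter_upwards [h1, ae_all_iff.2 hf] with x hx1 hx2
  refine tendsto_nhds_unique hx1 ?_
  refine ((Complex.continuous_ofReal.tendsto _).comp hx1.norm).congr fun n => ?_
  exact (hx2 (φ n)).symm

/-- The energy space is complete. -/
theorem exists_energyTendsto {f : ℕ → energySpace}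
    (hm : Tendsto (fun p : ℕ × ℕ => mass (f p.1 - f p.2)) atTop (𝓝 0))
    (hQ : Tendsto (fun p : ℕ × ℕ => gradSq (f p.1 - f p.2) + momentSq (f p.1 - f p.2)) atTop (𝓝 0))
    (hq : Tendsto (fun p : ℕ × ℕ => quarticNorm (f p.1 - f p.2)) atTop (𝓝 0)) :
    ∃ u, EnergyTendsto f u := by
  obtain ⟨u, hu⟩ := cauchySeq_tendsto_of_complete
    (cauchySeq_of_pow (f := fun n => (f n : L2)) two_ne_zero hm)
  have hg : ∀ i, ∃ g, Tendsto (fun n => weakPartial i (f n)) atTop (𝓝 g) := fun i => by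
    refine cauchySeq_tendsto_of_complete (cauchySeq_of_pow two_ne_zero
      (squeeze_zero (fun _ => by positivity) (fun p => ?_) hQ))
    rw [← weakPartial_sub]
    have h1 : ‖weakPartial i (f p.1 - f p.2)‖ ^ 2 ≤ gradSq (f p.1 - f p.2) :=
      Finset.single_le_sum (f := fun i => ‖weakPartial i (f p.1 - f p.2)‖ ^ 2)
        (fun _ _ => sq_nonneg _) (Finset.mem_univ i)
    linarith [momentSq_nonneg (f p.1 - f p.2)]
  choose g hg using hg
  obtain ⟨w, hw⟩ : ∃ w, Tendsto (fun n => weighted (f n)) atTop (𝓝 w) := by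
    refine cauchySeq_tendsto_of_complete (cauchySeq_of_pow two_ne_zero
      (squeeze_zero (fun _ => by positivity) (fun p => ?_) hQ))
    rw [← weighted_sub, norm_weighted_sq]
    linarith [gradSq_nonneg (f p.1 - f p.2)]
  obtain ⟨q, hq⟩ : ∃ q, Tendsto (fun n => toL4 (f n)) atTop (𝓝 q) := by
    refine cauchySeq_tendsto_of_complete (cauchySeq_of_pow four_ne_zero (hq.congr fun p => ?_))
    rw [← toL4_sub, norm_toL4_pow]
  have hpart : ∀ i, IsWeakPartial i u (g i) := fun i =>
    IsWeakPartial.of_tendsto (fun n => weakPartial_spec i (f n)) hu (hg i)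
  have hwu : ∀ᵐ x : Plane, w x = (‖x‖ : ℂ) * u x :=
    ae_eq_mul_of_tendsto (fun n => coeFn_weighted (f n)) hu hw
  have hqu : ∀ᵐ x : Plane, q x = 1 * u x :=
    ae_eq_mul_of_tendsto (fun n => by simpa using coeFn_toL4 (f n)) hu hq
  let v : energySpace := ⟨u, fun i => ⟨g i, hpart i⟩, (Lp.memLp w).ae_eq hwu⟩
  refine ⟨v, hu, fun i => ?_, ?_, ?_⟩
  · rw [weakPartial_eq (u := v) (hpart i)]
    exact hg i
  · convert hw
    refine Lp.ext ?_
    filter_upwards [hwu, coeFn_weighted v] with x h1 h2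
    rw [h1, h2]
  · convert hq
    refine Lp.ext ?_
    filter_upwards [hqu, coeFn_toL4 v] with x h1 h2
    rw [h1, h2, one_mul]

/-! ### Minimising sequences, existence and continuous dependence -/

theorem momentSq_le_hamiltonian (u : energySpace) : momentSq u ≤ 2 * hamiltonian u := by
  have := gradSq_nonneg u
  have := quarticNorm_nonneg u
  unfold hamiltonian
  linarith

/-- Non-negative minimising sequences converge in the energy space, to a ground state. -/
theorem exists_energyTendsto_isGroundState {f : ℕ → energySpace} {M : ℝ} (hM : 0 < M)
    (hf : ∀ n, IsNonneg (f n)) (hmass : Tendsto (fun n => mass (f n)) atTop (𝓝 M))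
    (hH : Tendsto (fun n => hamiltonian (f n)) atTop (𝓝 (minEnergy M))) :
    ∃ u, EnergyTendsto f u ∧ IsGroundState M u := by
  have hfst : Tendsto (Prod.fst : ℕ × ℕ → ℕ) atTop atTop := by
    rw [← prod_atTop_atTop_eq]; exact tendsto_fst
  have hsnd : Tendsto (Prod.snd : ℕ × ℕ → ℕ) atTop atTop := by
    rw [← prod_atTop_atTop_eq]; exact tendsto_snd
  have hH2 : Tendsto (fun p : ℕ × ℕ => (hamiltonian (f p.1) + hamiltonian (f p.2)) / 2) atTop
      (𝓝 (minEnergy M)) := by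
    simpa using ((hH.comp hfst).add (hH.comp hsnd)).div_const 2
  have hm2 : Tendsto (fun p : ℕ × ℕ => (mass (f p.1) + mass (f p.2)) / 2) atTop (𝓝 M) := by
    simpa using ((hmass.comp hfst).add (hmass.comp hsnd)).div_const 2
  have hdefect : ∀ {N : ℕ × ℕ → ℝ} (c : ℝ), Tendsto N atTop (𝓝 M) → Tendsto (fun p : ℕ × ℕ =>
      c * ((hamiltonian (f p.1) + hamiltonian (f p.2)) / 2 - minEnergy (N p))) atTop (𝓝 0) :=
    fun c hN => by
      simpa using (hH2.sub ((continuousAt_minEnergy hM).tendsto.comp hN)).const_mul c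
  have hq : Tendsto (fun p : ℕ × ℕ => quarticNorm (f p.1 - f p.2)) atTop (𝓝 0) :=
    squeeze_zero (fun _ => quarticNorm_nonneg _)
      (fun p => quarticNorm_sub_le_energy (hf p.1) (hf p.2)) (hdefect 16 hm2)
  have hm : Tendsto (fun p : ℕ × ℕ => mass (f p.1 - f p.2)) atTop (𝓝 0) := by
    -- By the parallelogram law the moment of a difference is at most eight times the average
    -- energy.
    set C := 8 * (minEnergy M + 1) with hC
    have hC0 : 0 < C := by have := minEnergy_nonneg M; positivity
    have hmom : ∀ᶠ p : ℕ × ℕ in atTop, momentSq (f p.1 - f p.2) ≤ C := by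
      filter_upwards [hH2.eventually_le_const (lt_add_one (minEnergy M))] with p hp
      have h1 := momentSq_parallelogram (f p.1) (f p.2)
      have h2 := momentSq_nonneg (f p.1 + f p.2)
      have h3 := momentSq_le_hamiltonian (f p.1)
      have h4 := momentSq_le_hamiltonian (f p.2)
      linarith
    refine tendsto_order.2 ⟨fun a ha => Eventually.of_forall fun p => ha.trans_le (mass_nonneg _),
      fun ε hε => ?_⟩
    -- `R` and then `δ` make each of the three interpolation terms at most `ε / 4`; the `+ 1` in `δ`
    -- avoids division by zero.
    set R := √(C / (ε / 4)) with hR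
    have hR0 : 0 < R := Real.sqrt_pos.2 (by positivity)
    have hR2 : C / R ^ 2 = ε / 4 := by
      rw [hR, Real.sq_sqrt (by positivity)]
      field_simp
    set V := volume.real (Metric.ball (0 : Plane) R) with hV
    have hV0 : 0 ≤ V := measureReal_nonneg
    set δ := ε / 4 / (V + 1) with hδ
    have hδ0 : 0 < δ := by positivity
    have hδV : δ * V ≤ ε / 4 := by
      rw [hδ, div_mul_eq_mul_div, div_le_iff₀ (by positivity)]
      nlinarith
    filter_upwards [hmom, hq.eventually_lt_const (show 0 < ε / 4 * δ by positivity)] with p h1 h2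
    have h3 := mass_le_interpolation (f p.1 - f p.2) hR0 hδ0
    have h4 : momentSq (f p.1 - f p.2) / R ^ 2 ≤ C / R ^ 2 := by gcongr
    have h5 : quarticNorm (f p.1 - f p.2) / δ < ε / 4 := (div_lt_iff₀ hδ0).2 h2
    linarith
  -- The midpoint's mass is the average mass minus a quarter of the mass of the difference, so `L²`
  -- smallness must come before the gradient estimate.
  have hmid : Tendsto (fun p : ℕ × ℕ => mass ((1 / 2 : ℂ) • (f p.1 + f p.2))) atTop (𝓝 M) := by
    have h1 := hm2.sub (hm.div_const 4)
    rw [zero_div, sub_zero] at h1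
    refine h1.congr fun p => ?_
    have := mass_parallelogram (f p.1) (f p.2)
    rw [mass_smul]
    norm_num
    linarith
  have hQ : Tendsto (fun p : ℕ × ℕ => gradSq (f p.1 - f p.2) + momentSq (f p.1 - f p.2))
      atTop (𝓝 0) := by
    refine squeeze_zero (fun p => add_nonneg (gradSq_nonneg _) (momentSq_nonneg _)) (fun p => ?_)
      (hdefect 8 hmid)
    refine (gradSq_add_momentSq_sub_le _ _).trans ?_
    gcongr
    exact minEnergy_le rfl
  obtain ⟨u, hu⟩ := exists_energyTendsto hm hQ hq
  exact ⟨u, hu, isMinimizer_iff.2 ⟨tendsto_nhds_unique hu.tendsto_mass hmass,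
    tendsto_nhds_unique hu.tendsto_hamiltonian hH⟩, hu.isNonneg hf⟩

/-- Taking moduli keeps the mass and does not raise the energy, so a minimising sequence may be
taken non-negative. -/
theorem exists_isGroundState {M : ℝ} (hM : 0 < M) : ∃ u, IsGroundState M u := by
  obtain ⟨u₀, hu₀⟩ := exists_mass_eq hM
  obtain ⟨a, -, ha, hmem⟩ := exists_seq_tendsto_sInf
    (S := hamiltonian '' {u | mass u = M}) ⟨_, u₀, hu₀, rfl⟩ (bddBelow_hamiltonian _)
  choose f hf hfa using hmem
  have hmass : ∀ n, mass (meanState (f n) (f n)) = M := fun n =>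
    (mass_meanState_self _).trans (hf n)
  obtain ⟨u, -, hu⟩ := exists_energyTendsto_isGroundState (f := fun n => meanState (f n) (f n)) hM
    (fun n => meanState_nonneg _ _) (by simp only [hmass]; exact tendsto_const_nhds)
    (tendsto_of_tendsto_of_tendsto_of_le_of_le tendsto_const_nhds ha
      (fun n => minEnergy_le (hmass n))
      (fun n => (hamiltonian_meanState_self_le _).trans (hfa n).le))
  exact ⟨u, hu⟩

theorem tendsto_hamiltonian_of_isMinimizer {M : ℝ} {m : ℕ → ℝ} {v : energySpace}
    {f : ℕ → energySpace} (hM : 0 < M) (hm : Tendsto m atTop (𝓝 M)) (hv : IsMinimizer M v)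
    (hf : ∀ n, IsMinimizer (m n) (f n)) :
    Tendsto (fun n => hamiltonian (f n)) atTop (𝓝 (hamiltonian v)) := by
  rw [(isMinimizer_iff.1 hv).2]
  simp only [fun n => (isMinimizer_iff.1 (hf n)).2]
  exact (continuousAt_minEnergy hM).tendsto.comp hm

/-- Ground states depend continuously on the mass. -/
theorem energyTendsto_of_isGroundState {M : ℝ} {m : ℕ → ℝ} {v : energySpace}
    {f : ℕ → energySpace} (hM : 0 < M) (hm : Tendsto m atTop (𝓝 M)) (hv : IsGroundState M v)
    (hf : ∀ n, IsGroundState (m n) (f n)) : EnergyTendsto f v := by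
  have hH := tendsto_hamiltonian_of_isMinimizer hM hm hv.1 fun n => (hf n).1
  rw [(isMinimizer_iff.1 hv.1).2] at hH
  obtain ⟨u, hu, hgs⟩ := exists_energyTendsto_isGroundState hM (fun n => (hf n).2)
    (hm.congr fun n => (hf n).1.1.symm) hH
  rwa [hv.eq hgs]

/-! ### The pumping functional and the conclusion -/

/-- Multiplication of square-integrable functions by an essentially bounded one. -/
noncomputable def mulL2 {σ : Plane → ℝ} (hσ : MemLp σ ⊤ volume) : L2 →L[ℝ] L2 :=
  (ContinuousLinearMap.lsmul ℝ ℝ : ℝ →L[ℝ] ℂ →L[ℝ] ℂ).holderL volume ⊤ 2 2 (hσ.toLp σ)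

theorem coeFn_mulL2 {σ : Plane → ℝ} (hσ : MemLp σ ⊤ volume) (u : L2) :
    ∀ᵐ x, mulL2 hσ u x = σ x • u x := by
  filter_upwards [ContinuousLinearMap.coeFn_holder (r := 2)
    (ContinuousLinearMap.lsmul ℝ ℝ : ℝ →L[ℝ] ℂ →L[ℝ] ℂ) (hσ.toLp σ) u, hσ.coeFn_toLp] with x h1 h2
  rw [h2] at h1
  exact h1

theorem integral_weight_eq {σ : Plane → ℝ} (hσ : MemLp σ ⊤ volume) (u : L2) :
    ∫ x, σ x * ‖u x‖ ^ 2 = (inner ℂ u (mulL2 hσ u)).re := by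
  have h : inner ℂ u (mulL2 hσ u) = ((∫ x, σ x * ‖u x‖ ^ 2 : ℝ) : ℂ) := by
    rw [L2.inner_def, ← integral_complex_ofReal]
    refine integral_congr_ae ?_
    filter_upwards [coeFn_mulL2 hσ u] with x hx
    rw [hx, inner_smul_right_eq_smul, inner_self_eq_norm_sq_to_K]
    simp
  rw [h, Complex.ofReal_re]

/-- Displays the pumping as a bounded quadratic form on `L²` minus a multiple of the quartic norm,
both continuous under energy convergence. -/
theorem pumping_eq {σ : Plane → ℝ} (hσ : MemLp σ ⊤ volume) (α : ℝ) (u : energySpace) :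
    pumping σ α u = (inner ℂ (u : L2) (mulL2 hσ u)).re - α * quarticNorm u := by
  have hint : Integrable (fun x => σ x * ‖(u : L2) x‖ ^ 2) := by
    have := hσ.integrable_mul (p := ⊤) (q := 1) (memLp_one_iff_integrable.2 (integrable_sq (u : L2)))
    exact this
  rw [← integral_weight_eq, quarticNorm, ← integral_const_mul,
    ← integral_sub hint ((integrable_four u).const_mul α), pumping]
  exact integral_congr_ae (Eventually.of_forall fun x => by ring)

theorem EnergyTendsto.tendsto_pumping {f : ℕ → energySpace} {u : energySpace}
    (h : EnergyTendsto f u) {σ : Plane → ℝ} (hσ : MemLp σ ⊤ volume) (α : ℝ) :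
    Tendsto (fun n => pumping σ α (f n)) atTop (𝓝 (pumping σ α u)) := by
  simp only [pumping_eq hσ]
  refine Tendsto.sub ?_ (h.tendsto_quarticNorm.const_mul α)
  exact (Complex.continuous_re.tendsto _).comp
    (h.l2.inner (((mulL2 hσ).continuous.tendsto _).comp h.l2))

theorem pumping_meanState_self (σ : Plane → ℝ) (α : ℝ) (u : energySpace) :
    pumping σ α (meanState u u) = pumping σ α u := by
  refine integral_congr_ae ?_
  filter_upwards [norm_meanState_self u] with x hx
  rw [hx]

theorem proposition2 (σ : Plane → ℝ) (hσ_cont : Continuous σ) (hσ_nonneg : ∀ x, 0 ≤ σ x)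
    (hσ_ne : σ ≠ 0) (hσ_bdd : MemLp σ ∞ volume) (α : ℝ) (hα : 0 ≤ α) :
    (∀ M : ℝ, 0 < M → ∃! v : energySpace, IsGroundState M v) ∧
    (∀ M : ℝ, 0 < M → ∀ v : energySpace, IsMinimizer M v → minEnergy M = hamiltonian v) ∧
    ContinuousOn minEnergy (Ioi 0) ∧
    ∀ (M : ℝ) (Mn : ℕ → ℝ), 0 < M → (∀ n, 0 < Mn n) → Tendsto Mn atTop (𝓝 M) →
      (∀ (v : energySpace) (vn : ℕ → energySpace),
        IsGroundState M v → (∀ n, IsGroundState (Mn n) (vn n)) →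
          Tendsto (fun n => sigmaNorm (vn n - v)) atTop (𝓝 0) ∧
          Tendsto (fun n => quarticNorm (vn n - v)) atTop (𝓝 0)) ∧
      (∀ (v : energySpace) (vn : ℕ → energySpace),
        IsMinimizer M v → (∀ n, IsMinimizer (Mn n) (vn n)) →
          Tendsto (fun n => pumping σ α (vn n)) atTop (𝓝 (pumping σ α v)) ∧
          Tendsto (fun n => hamiltonian (vn n)) atTop (𝓝 (hamiltonian v))) := by
  refine ⟨fun M hM => ?_, fun M _ v hv => (isMinimizer_iff.1 hv).2.symm, continuousOn_minEnergy,
    fun M m hM _ hm => ⟨fun v f hv hf => ?_, fun v f hv hf => ⟨?_, ?_⟩⟩⟩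
  · obtain ⟨u, hu⟩ := exists_isGroundState hM
    exact ⟨u, hu, fun w hw => hw.eq hu⟩
  · have h := energyTendsto_of_isGroundState hM hm hv hf
    exact ⟨h.tendsto_sigmaNorm_sub, h.tendsto_quarticNorm_sub⟩
  · have h := energyTendsto_of_isGroundState hM hm hv.isGroundState_meanState
      fun n => (hf n).isGroundState_meanState
    simpa only [pumping_meanState_self] using h.tendsto_pumping hσ_bdd α
  · exact tendsto_hamiltonian_of_isMinimizer hM hm hv hf
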